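/- Let $d\ge 2$, let $z_1,\dots,z_d>0$ be even integers, and let $b_1,\dots,b_{d-1}\ge 0$ be integers each of which is odd or $0$; put $b_d=0$. For integers $y,c$ let $\eta(y,c)=1$ if $y>c$ and $\eta(y,c)=0$ otherwise. For $1\le k\le d$ let $$\alpha_k=z_d\prod_{j=0}^{k-2}\frac{z_{j+1}}{2},\qquad \eta_{\alpha_k}=\eta\Big(z_d(b_k+1)\prod_{j=0}^{k-2}\frac{z_{j+1}}{2},\ \alpha_k\Big),$$ and let $A_2=\eta\big(z_d(b_1+1)+1,\alpha_2\big)$, $$A_3=(2(b_1+1))^{1-A_2}\,z_1^{A_2},\qquad A_k=(b_{k-2}+1)^{(1-\eta_{\alpha_{k-1}})\eta_{\alpha_{k-2}}}\Big(\frac{z_{k-2}}{2}\Big)^{\eta_{\alpha_{k-1}}}\quad (4\le k\le d+1).$$ Assume that $4\mid z_d$, that $A_3\mid z_1$, and that $2A_{k+1}\mid z_{k-1}$ for all $3\le k\le d$. Then the torus $$C_{z_1}\,\square\, C_{z_d}\,\square\, C_{z_2}\,\square\, C_{z_3}\,\square\cdots\square\, C_{z_{d-1}}$$ (which is $C_{z_1}\square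 C_{z_2}$ for $d=2$ and $C_{z_1}\square C_{z_3}\square C_{z_2}$ for $d=3$) is the union of $$2\prod_{k=0}^{d-2}\frac{z_{k+1}}{A_{k+3}}$$ pairwise edge-disjoint subgraphs, each of which is a cycle of length $\frac{d z_d}{2}\prod_{k=0}^{d-2}A_{k+3}$ containing exactly $\frac{z_d}{2}\prod_{k=0}^{d-2}A_{k+3}$ edges from each of the $d$ dimensions (factors) of the torus. Here $C_n$ denotes the cycle of length $n\ge 2$; $C_2$ has two vertices joined by two parallel edges. -/

import Mathlib

namespace LockKey

open scoped Graph

/-- The torus `C_{n 0} □ C_{n 1} □ ⋯ □ C_{n (d-1)}` as a (multi)graph. The vertices are the tuples in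
`ℤ/n 0 × ⋯ × ℤ/n (d-1)`; for every vertex `x` and every dimension `i` there is an edge `(x, i)`,
coming from the factor `C_{n i}`, that joins `x` to the vertex obtained from `x` by adding `1` to
coordinate `i`. For `n i ≥ 3` this is the usual simple graph; the cycle `C_2` of length two has
two parallel edges. -/
def torus {d : ℕ} (n : Fin d → ℕ) :
    Graph (∀ i, ZMod (n i)) ((∀ i, ZMod (n i)) × Fin d) where
  vertexSet := Set.univ
  IsLink e x y :=
    (x = e.1 ∧ y = Function.update e.1 e.2 (e.1 e.2 + 1)) ∨
      (y = e.1 ∧ x = Function.update e.1 e.2 (e.1 e.2 + 1))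
  edgeSet := Set.univ
  isLink_symm := fun _ _ => ⟨fun _ _ h => h.symm⟩
  eq_or_eq_of_isLink_of_isLink := by
    rintro e x y v w (⟨rfl, rfl⟩ | ⟨rfl, rfl⟩) (⟨rfl, rfl⟩ | ⟨rfl, rfl⟩) <;> simp
  edge_mem_iff_exists_isLink := fun e =>
    ⟨fun _ => ⟨_, _, Or.inl ⟨rfl, rfl⟩⟩, fun _ => Set.mem_univ e⟩
  left_mem_of_isLink := fun _ _ _ _ => Set.mem_univ _

/-- The graph `H` is a cycle of length `L ≥ 2`: its vertices are `v 0, …, v (L-1)`, pairwise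
distinct, its edges are `e 0, …, e (L-1)`, pairwise distinct, and `e k` joins `v k` to `v (k+1)`,
indices being taken modulo `L`. -/
def IsCycleOfLength {α β : Type*} (H : Graph α β) (L : ℕ) : Prop :=
  2 ≤ L ∧ ∃ (v : ZMod L → α) (e : ZMod L → β),
    Function.Injective v ∧ Function.Injective e ∧
    V(H) = Set.range v ∧ E(H) = Set.range e ∧
    ∀ k, H.IsLink (e k) (v k) (v (k + 1))

/-- The family `H` of subgraphs of `G` is a decomposition of `G`: the union of the `H j` is `G`,
and the `H j` are pairwise edge-disjoint. -/
structure IsDecomposition {α β κ : Type*} (G : Graph α β) (H : κ → Graph α β) : Prop where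
  le : ∀ j, H j ≤ G
  vertexSet_eq : V(G) = ⋃ j, V(H j)
  edgeSet_eq : E(G) = ⋃ j, E(H j)
  disjoint : ∀ j j', j ≠ j' → Disjoint E(H j) E(H j')

/-- `η(y, c) = 1` if `y > c`, and `0` otherwise. -/
def eta (y c : ℕ) : ℕ := if c < y then 1 else 0

/-- `α_k = z_d ∏_{j=0}^{k-2} z_{j+1} / 2`. -/
def alphaMax (z : ℕ → ℕ) (d k : ℕ) : ℕ := z d * ∏ j ∈ Finset.range (k - 1), z (j + 1) / 2

/-- `η_{α_k} = η(z_d (b_k + 1) ∏_{j=0}^{k-2} z_{j+1} / 2, α_k)`, with the convention `b_d = 0`. -/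
def etaAlpha (z b : ℕ → ℕ) (d k : ℕ) : ℕ :=
  eta (z d * ((if k = d then 0 else b k) + 1) * ∏ j ∈ Finset.range (k - 1), z (j + 1) / 2)
    (alphaMax z d k)

/-- `A_2 = η(z_d (b_1 + 1) + 1, α_2)`. -/
def A₂ (z b : ℕ → ℕ) (d : ℕ) : ℕ := eta (z d * (b 1 + 1) + 1) (alphaMax z d 2)

/-- The numbers `A_k` for `3 ≤ k ≤ d + 1`: `A_3 = (2 (b_1 + 1))^{1 - A_2} z_1^{A_2}`, and
`A_k = (b_{k-2} + 1)^{(1 - η_{α_{k-1}}) η_{α_{k-2}}} (z_{k-2} / 2)^{η_{α_{k-1}}}` for `k ≥ 4`. -/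
def A (z b : ℕ → ℕ) (d k : ℕ) : ℕ :=
  if k = 3 then (2 * (b 1 + 1)) ^ (1 - A₂ z b d) * z 1 ^ A₂ z b d
  else (b (k - 2) + 1) ^ ((1 - etaAlpha z b d (k - 1)) * etaAlpha z b d (k - 2)) *
    (z (k - 2) / 2) ^ etaAlpha z b d (k - 1)

/-- The lengths of the factors of `C_{z_1} □ C_{z_d} □ C_{z_2} □ C_{z_3} □ ⋯ □ C_{z_{d-1}}`, in this
order. -/
def factorLength (z : ℕ → ℕ) (d : ℕ) (i : Fin d) : ℕ :=
  if (i : ℕ) = 0 then z 1 else if (i : ℕ) = 1 then z d else z i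

end LockKey

/-! The decomposition is built one factor at a time, and the invariant is balance: every cycle has
exactly `R` edges in each dimension, with `4 ∣ R`. The start is the single cycle of length `z_d`,
with `R = z_d`. Adjoining a factor `C_z` multiplies `R` by any `c` such that `2 * c ∣ z` and `c` is
`1`, even or `z / 2` (`HasBalancedDecomp.torus_option`). Since each `b_i` is odd or `0`, the choices
`c = A_3 / 2` for `z_1` and `c = A_k` for `z_{k-2}` are admissible, and counting edges then forces
the number of cycles.

To adjoin `C_z`, Hall's theorem assigns each vertex to one of the cycles through it so that each
cycle `p` receives a set `S` of exactly `R` vertices (`IsCycleDecomp.exists_assignment`). Vertical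
edges above `S` are reserved for lifts of `p`, so different cycles can be treated separately. Four
vertices of `S` cut `p` into four arcs, the first of which contains the other `R - 4`. With arcs
shrunk to edges, the cylinder over `p` becomes `C_4 □ C_z`. A suitable decomposition of the latter
(`exists_columnDecomp`) is pulled back: an edge of columns 1, 2, 3 becomes a copy of its arc at the
same height, and an edge of column 0 at height `h` becomes a zigzag that switches between `h` and `h
+ 1` at each inner vertex of `S`. It ends at height `h` again because `R - 4` is even. A cycle with
`c` edges in each column and `4 * c` rungs yields `c * R` edges in each old dimension and `4 * c + c
* (R - 4) = c * R` vertical ones. Zigzags at consecutive heights may collide, so no cycle of `C_4 □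
C_z` may use two consecutive edges of column 0. -/

namespace LockKey
open scoped Graph

/-! ### Walks as lists of darts, substitution of walks for edges, balanced decompositions. -/

section Walks

variable {V' E' : Type*} {V E ι : Type*}

/-- A dart `(e, b)` is the edge `e` traversed from `s e` to `t e` if `b = true`, and from `t e` to
`s e` otherwise. This is the vertex where the dart starts; the vertex where it ends is
`dartTail t s`. -/
def dartTail (s t : E → V) (a : E × Bool) : V := bif a.2 then s a.1 else t a.1

@[simp] theorem dartTail_true (s t : E → V) (e : E) : dartTail s t (e, true) = s e := rfl

@[simp] theorem dartTail_false (s t : E → V) (e : E) : dartTail s t (e, false) = t e := rfl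

/-- The list `l` of darts is a walk from `u` to `w`. -/
def IsWalk (s t : E → V) : V → List (E × Bool) → V → Prop
  | u, [], w => u = w
  | u, a :: l, w => dartTail s t a = u ∧ IsWalk s t (dartTail t s a) l w

/-- The walk `l` traversed backwards. -/
def revWalk (l : List (E × Bool)) : List (E × Bool) := (l.map fun a => (a.1, !a.2)).reverse

theorem IsWalk.append {s t : E → V} {u v w : V} {l l' : List (E × Bool)}
    (h : IsWalk s t u l v) (h' : IsWalk s t v l' w) : IsWalk s t u (l ++ l') w := by
  induction l generalizing u with
  | nil => cases h; exact h'
  | cons a l ih => exact ⟨h.1, ih h.2⟩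

theorem isWalk_append_iff {s t : E → V} {u w : V} {l l' : List (E × Bool)} :
    IsWalk s t u (l ++ l') w ↔ ∃ v, IsWalk s t u l v ∧ IsWalk s t v l' w := by
  refine ⟨fun h => ?_, fun ⟨v, h, h'⟩ => h.append h'⟩
  induction l generalizing u with
  | nil => exact ⟨u, rfl, h⟩
  | cons a l ih =>
    obtain ⟨v, h1, h2⟩ := ih h.2
    exact ⟨v, ⟨h.1, h1⟩, h2⟩

theorem dartTail_not (s t : E → V) (a : E × Bool) :
    dartTail s t (a.1, !a.2) = dartTail t s a := by
  rcases a with ⟨e, _ | _⟩ <;> rfl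

theorem IsWalk.rev {s t : E → V} {u w : V} {l : List (E × Bool)} (h : IsWalk s t u l w) :
    IsWalk s t w (revWalk l) u := by
  induction l generalizing u with
  | nil => exact h.symm
  | cons a l ih =>
    have : revWalk (a :: l) = revWalk l ++ [(a.1, !a.2)] := by simp [revWalk]
    rw [this]
    refine (ih h.2).append ⟨dartTail_not s t a, ?_⟩
    rw [dartTail_not, h.1]
    rfl

theorem map_tail_revWalk (s t : E → V) (l : List (E × Bool)) :
    (revWalk l).map (dartTail s t) = (l.map (dartTail t s)).reverse := by
  simp [revWalk, Function.comp_def, dartTail_not]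

theorem map_fst_revWalk (l : List (E × Bool)) :
    ((revWalk l).map Prod.fst).Perm (l.map Prod.fst) := by
  simp only [revWalk, List.map_reverse, List.map_map, Function.comp_def]
  exact List.reverse_perm _

theorem IsWalk.tails_append {s t : E → V} {u w : V} {l : List (E × Bool)}
    (h : IsWalk s t u l w) : l.map (dartTail s t) ++ [w] = u :: l.map (dartTail t s) := by
  induction l generalizing u with
  | nil => cases h; rfl
  | cons a l ih => simp [ih h.2, h.1]

theorem IsWalk.map {s t : E → V} {s' t' : E' → V'} {φ : V → V'} {ψ : E × Bool → E' × Bool}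
    (hs : ∀ a, dartTail s' t' (ψ a) = φ (dartTail s t a))
    (ht : ∀ a, dartTail t' s' (ψ a) = φ (dartTail t s a)) {u w : V}
    {l : List (E × Bool)} (h : IsWalk s t u l w) : IsWalk s' t' (φ u) (l.map ψ) (φ w) := by
  induction l generalizing u with
  | nil => cases h; rfl
  | cons a l ih =>
    obtain ⟨rfl, h⟩ := h
    refine ⟨hs a, ?_⟩
    rw [ht]
    exact ih h

theorem nodup_tails_map {s t : E → V} {s' t' : E' → V'} {φ : V → V'} (hφ : φ.Injective)
    {ψ : E × Bool → E' × Bool} (hs : ∀ a, dartTail s' t' (ψ a) = φ (dartTail s t a))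
    {l : List (E × Bool)} (hl : (l.map (dartTail s t)).Nodup) :
    ((l.map ψ).map (dartTail s' t')).Nodup := by
  have : (l.map ψ).map (dartTail s' t') = (l.map (dartTail s t)).map φ := by
    simp [hs]
  rw [this]
  exact hl.map hφ

theorem isWalk_flatMap_range {s t : E → V} (v : ℕ → V) (f : ℕ → List (E × Bool)) (n : ℕ)
    (h : ∀ k < n, IsWalk s t (v k) (f k) (v (k + 1))) :
    IsWalk s t (v 0) ((List.range n).flatMap f) (v n) := by
  induction n with
  | zero => rfl
  | succ n ih =>
    rw [List.range_succ, List.flatMap_append]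
    refine (ih fun k hk => h k (hk.trans n.lt_succ_self)).append ?_
    simpa using h n n.lt_succ_self

/-- Replace a dart by the walk `P e`, respectively its reverse. -/
def expand (P : E → List (E' × Bool)) (a : E × Bool) : List (E' × Bool) :=
  bif a.2 then P a.1 else revWalk (P a.1)

theorem isWalk_flatMap_expand {s t : E → V} {s' t' : E' → V'} {φ : V → V'}
    {P : E → List (E' × Bool)} (hP : ∀ e, IsWalk s' t' (φ (s e)) (P e) (φ (t e))) {u w : V}
    {l : List (E × Bool)} (h : IsWalk s t u l w) :
    IsWalk s' t' (φ u) (l.flatMap (expand P)) (φ w) := by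
  induction l generalizing u with
  | nil => cases h; rfl
  | cons a l ih =>
    rw [List.flatMap_cons]
    refine IsWalk.append ?_ (ih h.2)
    obtain ⟨rfl, -⟩ := h
    rcases a with ⟨e, _ | _⟩
    · exact (hP e).rev
    · exact hP e

/-- The list of tails omits the last vertex of a walk. Reversing `P e` therefore replaces the
endpoint `φ (s e)` by `φ (t e)` and keeps the inner vertices `I e` up to order. -/
theorem tails_expand_perm {s t : E → V} {s' t' : E' → V'} {φ : V → V'}
    {P : E → List (E' × Bool)} (hP : ∀ e, IsWalk s' t' (φ (s e)) (P e) (φ (t e)))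
    {I : E → List V'} (hI : ∀ e, (P e).map (dartTail s' t') = φ (s e) :: I e) (a : E × Bool) :
    ((expand P a).map (dartTail s' t')).Perm (φ (dartTail s t a) :: I a.1) := by
  rcases a with ⟨e, _ | _⟩
  · have h := (hP e).tails_append
    rw [hI, List.cons_append, List.cons.injEq] at h
    simp only [expand, cond_false, map_tail_revWalk, ← h.2, dartTail_false]
    simp
  · simp only [expand, cond_true, hI, dartTail_true, List.Perm.refl]

theorem map_fst_expand (P : E → List (E' × Bool)) (a : E × Bool) :
    ((expand P a).map Prod.fst).Perm ((P a.1).map Prod.fst) := by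
  rcases a with ⟨e, _ | _⟩
  · exact map_fst_revWalk _
  · exact List.Perm.refl _

/-- Disjointness of inner vertices is required only for edges on the same walk `l`. This leaves room
for substituted walks that overlap, as long as no single cycle uses both. -/
theorem nodup_tails_flatMap_expand {s t : E → V} {s' t' : E' → V'} {φ : V → V'}
    (hφ : φ.Injective)
    {P : E → List (E' × Bool)} (hP : ∀ e, IsWalk s' t' (φ (s e)) (P e) (φ (t e)))
    {I : E → List V'} (hI : ∀ e, (P e).map (dartTail s' t') = φ (s e) :: I e)
    (hIn : ∀ e, (I e).Nodup) (hIφ : ∀ e v, φ v ∉ I e)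
    {l : List (E × Bool)} (hl : (l.map (dartTail s t)).Nodup) (hl' : (l.map Prod.fst).Nodup)
    (hd : ∀ e ∈ l.map Prod.fst, ∀ e' ∈ l.map Prod.fst, e ≠ e' → (I e).Disjoint (I e')) :
    ((l.flatMap (expand P)).map (dartTail s' t')).Nodup := by
  rw [List.map_flatMap, List.nodup_flatMap]
  constructor
  · intro a _
    rw [(tails_expand_perm hP hI a).nodup_iff, List.nodup_cons]
    exact ⟨hIφ _ _, hIn _⟩
  · have h := (List.pairwise_map.1 hl).and (List.pairwise_map.1 hl')
    refine h.imp_of_mem fun {a b} ha hb hab => ?_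
    intro x hx hxb
    have hx := (tails_expand_perm hP hI a).subset hx
    have hxb := (tails_expand_perm hP hI b).subset hxb
    rw [List.mem_cons] at hx hxb
    rcases hx with rfl | hx <;> rcases hxb with hxb | hxb
    · exact hab.1 (hφ hxb)
    · exact hIφ _ _ hxb
    · exact hIφ a.1 _ (hxb ▸ hx)
    · exact hd _ (List.mem_map_of_mem ha) _ (List.mem_map_of_mem hb) hab.2 hx hxb

/-- The number of occurrences of `a` in `l`. -/
def occ {α : Type*} [DecidableEq α] (a : α) (l : List α) : ℕ := l.count a

section Occ

variable {α β : Type*} [DecidableEq α]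

@[simp] theorem occ_nil (a : α) : occ a [] = 0 := List.count_nil

theorem occ_cons (a b : α) (l : List α) :
    occ a (b :: l) = occ a l + if b = a then 1 else 0 := by
  simp [occ, List.count_cons]

theorem occ_append (a : α) (l l' : List α) : occ a (l ++ l') = occ a l + occ a l' :=
  List.count_append

theorem occ_perm {l l' : List α} (h : l.Perm l') (a : α) : occ a l = occ a l' := h.count_eq a

theorem occ_flatMap (a : α) (l : List β) (f : β → List α) :
    occ a (l.flatMap f) = (l.map fun b => occ a (f b)).sum := by
  simp [occ, List.count_flatMap, Function.comp_def]

theorem occ_eq_zero {a : α} {l : List α} : occ a l = 0 ↔ a ∉ l := List.count_eq_zero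

theorem occ_pos {a : α} {l : List α} : 0 < occ a l ↔ a ∈ l := List.count_pos_iff

theorem occ_eq_one {a : α} {l : List α} (hl : l.Nodup) (h : a ∈ l) : occ a l = 1 :=
  List.count_eq_one_of_mem hl h

theorem sum_occ_eq_length [Fintype α] (l : List α) : ∑ a, occ a l = l.length := by
  simpa [occ] using Multiset.sum_count_eq_card (s := Finset.univ) (m := (l : Multiset α))
    (fun _ _ => Finset.mem_univ _)

end Occ

theorem sum_map_comp_eq {α β : Type*} [Fintype β] [DecidableEq β] (g : α → β) (w : β → ℕ)
    (l : List α) : (l.map fun a => w (g a)).sum = ∑ b, occ b (l.map g) * w b := by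
  induction l with
  | nil => simp
  | cons a l ih =>
    simp only [List.map_cons, List.sum_cons, ih, occ_cons, add_mul,
      Finset.sum_add_distrib]
    simp [add_comm]

/-- A family of closed walks without repeated vertices which together use every edge exactly once. -/
structure IsCycleDecomp {J : Type*} [Fintype J] [DecidableEq E] (s t : E → V)
    (l : J → List (E × Bool)) : Prop where
  closed : ∀ j, ∃ u, IsWalk s t u (l j) u
  nodup : ∀ j, ((l j).map (dartTail s t)).Nodup
  cover : ∀ e, ∑ j, occ e ((l j).map Prod.fst) = 1

/-- The graph has a decomposition into cycles with exactly `R` edges of each colour. -/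
def HasBalancedDecomp [DecidableEq E] [DecidableEq ι] (s t : E → V) (dim : E → ι) (R : ℕ) :
    Prop :=
  ∃ (J : Type) (_ : Fintype J) (l : J → List (E × Bool)), IsCycleDecomp s t l ∧
    ∀ j i, occ i ((l j).map fun a => dim a.1) = R

theorem IsCycleDecomp.count_le_one {J : Type*} [Fintype J] [DecidableEq E] {s t : E → V}
    {l : J → List (E × Bool)} (h : IsCycleDecomp s t l) (j : J) (e : E) :
    occ e ((l j).map Prod.fst) ≤ 1 := by
  rw [← h.cover e]
  exact Finset.single_le_sum (f := fun j => occ e ((l j).map Prod.fst))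
    (fun _ _ => Nat.zero_le _) (Finset.mem_univ j)

theorem IsCycleDecomp.nodup_edges {J : Type*} [Fintype J] [DecidableEq E] {s t : E → V}
    {l : J → List (E × Bool)} (h : IsCycleDecomp s t l) (j : J) : ((l j).map Prod.fst).Nodup :=
  List.nodup_iff_count_le_one.2 (h.count_le_one j)

end Walks
-- Distributing the vertices evenly among the cycles.
section Assignment

variable {V E ι J : Type*} [DecidableEq ι]
  {s t : E → V} {l : J → List (E × Bool)}

theorem IsWalk.count_tail_eq [DecidableEq V] {u : V} {p : List (E × Bool)}
    (h : IsWalk s t u p u) (v : V) :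
    occ v (p.map (dartTail s t)) = occ v (p.map (dartTail t s)) := by
  have h := congrArg (occ v) h.tails_append
  simp only [occ_append, occ_cons, occ_nil] at h
  omega

theorem IsCycleDecomp.sum_sum_map [Fintype J] [DecidableEq E] [Fintype E] (h : IsCycleDecomp s t l) (w : E → ℕ) :
    ∑ j, ((l j).map fun a => w a.1).sum = ∑ e, w e := by
  simp only [sum_map_comp_eq Prod.fst w]
  rw [Finset.sum_comm]
  refine Finset.sum_congr rfl fun e _ => ?_
  rw [← Finset.sum_mul, h.cover, one_mul]

theorem count_tail_add_count_head [DecidableEq V] (p : List (E × Bool)) (v : V) :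
    occ v (p.map (dartTail s t)) + occ v (p.map (dartTail t s)) =
      (p.map fun a => (if s a.1 = v then 1 else 0) + (if t a.1 = v then 1 else 0)).sum := by
  induction p with
  | nil => simp
  | cons a p ih =>
    rcases a with ⟨e, _ | _⟩ <;>
    · simp only [List.map_cons, occ_cons, List.sum_cons, ← ih, dartTail_false,
        dartTail_true]
      omega

/-- There are `2 * d` incidences of edges with `v`, and a closed walk leaves `v` as often as it
enters it. -/
theorem IsCycleDecomp.sum_count_tail [Fintype J] [DecidableEq E] [Fintype E] [DecidableEq V] (h : IsCycleDecomp s t l)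
    {d : ℕ} (v : V) (hs : (Finset.univ.filter fun e => s e = v).card = d)
    (ht : (Finset.univ.filter fun e => t e = v).card = d) :
    ∑ j, occ v ((l j).map (dartTail s t)) = d := by
  have h1 := h.sum_sum_map fun e =>
    (if s e = v then 1 else 0) + (if t e = v then 1 else 0)
  have h2 : ∀ j, occ v ((l j).map (dartTail s t)) = occ v ((l j).map (dartTail t s)) :=
    fun j => (h.closed j).elim fun u hu => hu.count_tail_eq v
  simp only [← count_tail_add_count_head, Finset.sum_add_distrib, ← h2] at h1
  rw [Finset.sum_boole, Finset.sum_boole, hs, ht] at h1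
  simp only [Nat.cast_id] at h1
  omega

theorem length_eq_of_count [Fintype ι] {R : ℕ} {p : List (E × Bool)} {dim : E → ι}
    (h : ∀ i, occ i (p.map fun a => dim a.1) = R) : p.length = Fintype.card ι * R := by
  have := sum_occ_eq_length (p.map fun a => dim a.1)
  simp only [h, List.length_map] at this
  simpa using this.symm

/-- The vertices can be assigned to the cycles through them in such a way that each cycle
receives the same number of vertices. -/
theorem IsCycleDecomp.exists_assignment [Fintype J] [Fintype V] [DecidableEq V] [Fintype E]
    [DecidableEq E] [Fintype ι]
    [Nonempty ι] [DecidableEq J] (h : IsCycleDecomp s t l) {dim : E → ι} {R : ℕ} (hR : 0 < R)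
    (hs : ∀ v, (Finset.univ.filter fun e => s e = v).card = Fintype.card ι)
    (ht : ∀ v, (Finset.univ.filter fun e => t e = v).card = Fintype.card ι)
    (hc : ∀ j i, occ i ((l j).map fun a => dim a.1) = R) :
    ∃ f : V → J, (∀ v, v ∈ (l (f v)).map (dartTail s t)) ∧
      ∀ j, (Finset.univ.filter fun v => f v = j).card = R := by
  have hd : 0 < Fintype.card ι := Fintype.card_pos
  have hlen : ∀ j, (l j).length = Fintype.card ι * R := fun j => length_eq_of_count (hc j)
  have hcount : ∀ j v, occ v ((l j).map (dartTail s t)) =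
      if v ∈ (l j).map (dartTail s t) then 1 else 0 := by
    intro j v
    split_ifs with hv
    · exact occ_eq_one (h.nodup j) hv
    · exact occ_eq_zero.2 hv
  have hdeg : ∀ v, (Finset.univ.filter fun j => v ∈ (l j).map (dartTail s t)).card =
      Fintype.card ι := by
    intro v
    have := h.sum_count_tail v (hs v) (ht v)
    simpa only [hcount, Finset.sum_boole, Nat.cast_id] using this
  have hcard : Fintype.card V = Fintype.card J * R := by
    have h1 : ∑ v : V, ∑ j, occ v ((l j).map (dartTail s t)) =
        Fintype.card V * Fintype.card ι := by
      simp only [h.sum_count_tail _ (hs _) (ht _), Finset.sum_const, Finset.card_univ,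
        smul_eq_mul]
    have h2 : ∀ j, ∑ v : V, occ v ((l j).map (dartTail s t)) = Fintype.card ι * R := by
      intro j
      simp [sum_occ_eq_length, hlen]
    rw [Finset.sum_comm] at h1
    simp only [h2, Finset.sum_const, Finset.card_univ, smul_eq_mul] at h1
    refine Nat.eq_of_mul_eq_mul_right hd ?_
    rw [← h1]
    ring
  -- Each cycle offers `R` slots, and a vertex may take any slot of a cycle through it. A vertex has
  -- `card ι * R` neighbours and a slot at most that many, which gives Hall's condition. By `hcard`
  -- the resulting injection is a bijection, so every slot is filled.
  let nb : V → Finset (J × Fin R) := fun v =>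
    (Finset.univ.filter fun j => v ∈ (l j).map (dartTail s t)) ×ˢ Finset.univ
  have hall : ∀ A : Finset V, A.card ≤ (A.biUnion nb).card := by
    intro A
    have := Finset.card_mul_le_card_mul (s := A) (t := A.biUnion nb)
      (fun v p => v ∈ (l p.1).map (dartTail s t)) (m := Fintype.card ι * R)
      (n := Fintype.card ι * R) ?_ ?_
    · exact Nat.le_of_mul_le_mul_right this (Nat.mul_pos hd hR)
    · intro v hv
      have hsub : nb v ⊆ Finset.bipartiteAbove
          (fun v (p : J × Fin R) => v ∈ (l p.1).map (dartTail s t)) (A.biUnion nb) v := by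
        intro p hp
        rw [Finset.mem_bipartiteAbove]
        refine ⟨Finset.mem_biUnion.2 ⟨v, hv, hp⟩, ?_⟩
        simpa [nb] using hp
      refine le_trans (le_of_eq ?_) (Finset.card_le_card hsub)
      simp only [nb, Finset.card_product, hdeg, Finset.card_univ, Fintype.card_fin]
    · intro p _
      refine (Finset.card_le_card (t := ((l p.1).map (dartTail s t)).toFinset) ?_).trans
        ((List.toFinset_card_le _).trans ?_)
      · intro v hv
        rw [Finset.mem_bipartiteBelow] at hv
        exact List.mem_toFinset.2 hv.2
      · rw [List.length_map, hlen]
  obtain ⟨g, hginj, hg⟩ := (Finset.all_card_le_biUnion_card_iff_exists_injective nb).1 hall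
  have hbij : Function.Bijective g :=
    (Fintype.bijective_iff_injective_and_card g).2 ⟨hginj, by simp [hcard]⟩
  refine ⟨fun v => (g v).1, fun v => ?_, fun j => ?_⟩
  · have := hg v
    simp only [nb, Finset.mem_product, Finset.mem_filter] at this
    exact this.1.2
  · have h1 : (Finset.univ.filter fun v => (g v).1 = j).card =
        (Finset.univ.filter fun p : J × Fin R => p.1 = j).card := by
      refine Finset.card_bij (fun v _ => g v) (by simp) (fun _ _ _ _ h => hginj h) ?_
      intro p hp
      obtain ⟨v, rfl⟩ := hbij.2 p
      exact ⟨v, by simpa using hp, rfl⟩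
    have h2 : (Finset.univ.filter fun p : J × Fin R => p.1 = j) = {j} ×ˢ Finset.univ := by
      ext p
      simp only [Finset.mem_filter, Finset.mem_univ, true_and, Finset.mem_product,
        Finset.mem_singleton, and_true]
    rw [h1, h2]
    simp

end Assignment
-- The product of a graph with a cycle, cutting closed walks into arcs, zigzag lifts.
section Cylinder

variable {V E ι : Type*} {z : ℕ}

/-- The sources of the edges of the product of a graph with the cycle `C_z`. -/
def cylSrc (z : ℕ) (s : E → V) : (E × ZMod z) ⊕ (V × ZMod z) → V × ZMod z :=
  Sum.elim (fun p => (s p.1, p.2)) id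

/-- The targets of the edges of the product of a graph with the cycle `C_z`. -/
def cylTgt (z : ℕ) (t : E → V) : (E × ZMod z) ⊕ (V × ZMod z) → V × ZMod z :=
  Sum.elim (fun p => (t p.1, p.2)) (fun p => (p.1, p.2 + 1))

/-- The dimensions of the edges of the product of a graph with the cycle `C_z`. -/
def cylDim (z : ℕ) (dim : E → ι) : (E × ZMod z) ⊕ (V × ZMod z) → Option ι :=
  Sum.elim (fun p => some (dim p.1)) (fun _ => none)

@[simp] theorem cylSrc_inl (s : E → V) (e : E) (h : ZMod z) :
    cylSrc z s (.inl (e, h)) = (s e, h) := rfl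
@[simp] theorem cylSrc_inr (s : E → V) (v : V) (h : ZMod z) :
    cylSrc z s (.inr (v, h)) = (v, h) := rfl
@[simp] theorem cylTgt_inl (t : E → V) (e : E) (h : ZMod z) :
    cylTgt z t (.inl (e, h)) = (t e, h) := rfl
@[simp] theorem cylTgt_inr (t : E → V) (v : V) (h : ZMod z) :
    cylTgt z t (.inr (v, h)) = (v, h + 1) := rfl
@[simp] theorem cylDim_inl (dim : E → ι) (e : E) (h : ZMod z) :
    cylDim (V := V) z dim (.inl (e, h)) = some (dim e) := rfl
@[simp] theorem cylDim_inr (dim : E → ι) (v : V) (h : ZMod z) :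
    cylDim z dim (.inr (v, h)) = none := rfl

theorem dartTail_lift (s t : E → V) (a : E × Bool) (h : ZMod z) :
    dartTail (cylSrc z s) (cylTgt z t) (.inl (a.1, h), a.2) = (dartTail s t a, h) := by
  rcases a with ⟨e, _ | _⟩ <;> rfl

theorem dartHead_lift (s t : E → V) (a : E × Bool) (h : ZMod z) :
    dartTail (cylTgt z t) (cylSrc z s) (.inl (a.1, h), a.2) = (dartTail t s a, h) := by
  rcases a with ⟨e, _ | _⟩ <;> rfl

theorem exists_split_first {α : Type*} (S : α → Prop) [DecidablePred S] (l : List α)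
    (h : 0 < l.countP S) : ∃ l₁ a l₂, l = l₁ ++ a :: l₂ ∧ S a ∧ ∀ x ∈ l₁, ¬ S x := by
  induction l with
  | nil => simp at h
  | cons b l ih =>
    by_cases hb : S b
    · exact ⟨[], b, l, rfl, hb, by simp⟩
    · rw [List.countP_cons_of_neg (by simpa using hb)] at h
      obtain ⟨l₁, a, l₂, rfl, ha, h1⟩ := ih h
      exact ⟨b :: l₁, a, l₂, rfl, ha, by simpa [hb] using h1⟩

theorem exists_split_last {α : Type*} (S : α → Prop) [DecidablePred S] (l : List α)
    (h : 0 < l.countP S) : ∃ l₁ a l₂, l = l₁ ++ a :: l₂ ∧ S a ∧ (∀ x ∈ l₂, ¬ S x) ∧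
      l.countP S = l₁.countP S + 1 := by
  obtain ⟨l₁, a, l₂, h1, ha, h2⟩ := exists_split_first S l.reverse (by simpa using h)
  refine ⟨l₂.reverse, a, l₁.reverse, ?_, ha, by simpa using h2, ?_⟩
  · rw [← List.reverse_reverse l, h1]
    simp
  · have h3 : l₁.countP S = 0 := List.countP_eq_zero.2 (by simpa using h2)
    rw [← List.countP_reverse, h1]
    simp [List.countP_append, ha, h3]

/-- A closed walk with at least four vertices in `S` is cut, up to rotation, into four arcs that
start in `S`, only the first of which contains further vertices in `S`. -/
theorem IsWalk.exists_arcs {s t : E → V} {u : V} {p : List (E × Bool)} (hp : IsWalk s t u p u)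
    (S : V → Prop) [DecidablePred S] (h4 : 4 ≤ p.countP fun a => S (dartTail s t a)) :
    ∃ (a : Fin 4 → E × Bool) (r : Fin 4 → List (E × Bool)),
      ((List.finRange 4).flatMap fun i => a i :: r i).Perm p ∧
      (∀ i, IsWalk s t (dartTail s t (a i)) (a i :: r i) (dartTail s t (a (i + 1)))) ∧
      (∀ i, S (dartTail s t (a i))) ∧
      ∀ i, i ≠ 0 → ∀ x ∈ r i, ¬ S (dartTail s t x) := by
  obtain ⟨p3, a3, r3, rfl, ha3, hr3, hc3⟩ := exists_split_last (fun a => S (dartTail s t a)) p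
    (by omega)
  obtain ⟨p2, a2, r2, rfl, ha2, hr2, hc2⟩ := exists_split_last (fun a => S (dartTail s t a)) p3
    (by omega)
  obtain ⟨p1, a1, r1, rfl, ha1, hr1, hc1⟩ := exists_split_last (fun a => S (dartTail s t a)) p2
    (by omega)
  obtain ⟨q, a0, r0, rfl, ha0, hq⟩ := exists_split_first (fun a => S (dartTail s t a)) p1
    (by omega)
  obtain ⟨v3, hp, w3⟩ := isWalk_append_iff.1 hp
  obtain ⟨v2, hp, w2⟩ := isWalk_append_iff.1 hp
  obtain ⟨v1, hp, w1⟩ := isWalk_append_iff.1 hp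
  obtain ⟨v0, hq', w0⟩ := isWalk_append_iff.1 hp
  obtain rfl := w0.1
  obtain rfl := w1.1
  obtain rfl := w2.1
  obtain rfl := w3.1
  -- Three cuts at the last vertices in `S` and one at the first leave all the surplus vertices of
  -- `S` in `r0`. The prefix `q` before the first cut contains none and is rotated to the end of the
  -- last arc.
  refine ⟨![a0, a1, a2, a3], ![r0, r1, r2, r3 ++ q], ?_, ?_, ?_, ?_⟩
  · have e0 : List.finRange 4 = [0, 1, 2, 3] := rfl
    simp only [e0, List.flatMap_cons, List.flatMap_nil, List.append_nil, Matrix.cons_val]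
    have e1 : (a0 :: r0) ++ ((a1 :: r1) ++ ((a2 :: r2) ++ (a3 :: (r3 ++ q)))) =
        ((a0 :: r0) ++ ((a1 :: r1) ++ ((a2 :: r2) ++ (a3 :: r3)))) ++ q := by simp
    have e2 : q ++ a0 :: r0 ++ a1 :: r1 ++ a2 :: r2 ++ a3 :: r3 =
        q ++ ((a0 :: r0) ++ ((a1 :: r1) ++ ((a2 :: r2) ++ (a3 :: r3)))) := by simp
    rw [e1, e2]
    exact List.perm_append_comm
  · intro i
    fin_cases i
    · exact w0
    · exact w1
    · exact w2
    · exact w3.append hq'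
  · intro i
    fin_cases i
    exacts [ha0, ha1, ha2, ha3]
  · intro i hi
    fin_cases i
    · exact absurd rfl hi
    · exact hr1
    · exact hr2
    · intro x hx
      rcases List.mem_append.1 hx with hx | hx
      exacts [hr3 x hx, hq x hx]

/-- Lift a walk to the cylinder, changing between the heights `h` and `h + 1` at each vertex
in `S`; the flag tells whether the walk is at height `h + 1`. -/
def zigzag (s t : E → V) (S : V → Prop) [DecidablePred S] (h : ZMod z) :
    Bool → List (E × Bool) → List (((E × ZMod z) ⊕ (V × ZMod z)) × Bool)
  | _, [] => []
  | b, a :: l =>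
    if S (dartTail s t a) then
      (.inr (dartTail s t a, h), !b) :: (.inl (a.1, h + bif b then 0 else 1), a.2) ::
        zigzag s t S h (!b) l
    else (.inl (a.1, h + bif b then 1 else 0), a.2) :: zigzag s t S h b l

variable {s t : E → V} {S : V → Prop} [DecidablePred S]

/-- Each vertex in `S` flips the flag, so only the parity of their number affects the final height.
-/
theorem IsWalk.zigzag {u w : V} {l : List (E × Bool)} (hl : IsWalk s t u l w) (h : ZMod z)
    (b : Bool) :
    IsWalk (cylSrc z s) (cylTgt z t) (u, h + bif b then 1 else 0) (zigzag s t S h b l)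
      (w, h + bif (b ^^ (l.countP fun a => S (dartTail s t a)).bodd) then 1 else 0) := by
  induction l generalizing u b with
  | nil =>
    cases hl
    simp [LockKey.zigzag, IsWalk]
  | cons a l ih =>
    obtain ⟨rfl, hl⟩ := hl
    by_cases ha : S (dartTail s t a)
    · rw [LockKey.zigzag, if_pos ha, List.countP_cons_of_pos (by simpa using ha)]
      refine ⟨by cases b <;> simp, ?_, ?_⟩
      · rw [dartTail_lift]
        cases b <;> simp
      · rw [dartHead_lift]
        have := ih hl (!b)
        cases b <;> simpa using this
    · rw [LockKey.zigzag, if_neg ha, List.countP_cons_of_neg (by simpa using ha)]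
      refine ⟨dartTail_lift _ _ _ _, ?_⟩
      rw [dartHead_lift]
      exact ih hl b

theorem mem_tails_zigzag {h : ZMod z} {b : Bool} {l : List (E × Bool)} {x : V × ZMod z}
    (hx : x ∈ (zigzag s t S h b l).map (dartTail (cylSrc z s) (cylTgt z t))) :
    x.1 ∈ l.map (dartTail s t) ∧ (x.2 = h ∨ x.2 = h + 1) := by
  induction l generalizing b with
  | nil => simp [zigzag] at hx
  | cons a l ih =>
    by_cases ha : S (dartTail s t a)
    · rw [zigzag, if_pos ha] at hx
      simp only [List.map_cons, List.mem_cons, dartTail_lift] at hx ⊢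
      rcases hx with rfl | rfl | hx
      · cases b <;> simp
      · cases b <;> simp
      · exact ⟨.inr (ih hx).1, (ih hx).2⟩
    · rw [zigzag, if_neg ha] at hx
      simp only [List.map_cons, List.mem_cons, dartTail_lift] at hx ⊢
      rcases hx with rfl | hx
      · cases b <;> simp
      · exact ⟨.inr (ih hx).1, (ih hx).2⟩

theorem snd_eq_of_mem_tails_zigzag {h : ZMod z} {l : List (E × Bool)} {x : V × ZMod z}
    (hl : ∀ a ∈ l, ¬ S (dartTail s t a))
    (hx : x ∈ (zigzag s t S h false l).map (dartTail (cylSrc z s) (cylTgt z t))) :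
    x.2 = h := by
  induction l with
  | nil => simp [zigzag] at hx
  | cons a l ih =>
    rw [zigzag, if_neg (hl a List.mem_cons_self)] at hx
    simp only [List.map_cons, List.mem_cons, dartTail_lift] at hx
    rcases hx with rfl | hx
    · simp
    · exact ih (fun a ha => hl a (List.mem_cons_of_mem _ ha)) hx

theorem nodup_tails_zigzag (hz : 1 < z) (h : ZMod z) (b : Bool) {l : List (E × Bool)}
    (hl : (l.map (dartTail s t)).Nodup) :
    ((zigzag s t S h b l).map (dartTail (cylSrc z s) (cylTgt z t))).Nodup := by
  have : Fact (1 < z) := ⟨hz⟩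
  induction l generalizing b with
  | nil => simp [zigzag]
  | cons a l ih =>
    rw [List.map_cons, List.nodup_cons] at hl
    have key : ∀ y b, (dartTail s t a, y) ∉
        (zigzag s t S h b l).map (dartTail (cylSrc z s) (cylTgt z t)) :=
      fun y b hy => hl.1 (mem_tails_zigzag hy).1
    by_cases ha : S (dartTail s t a)
    · rw [zigzag, if_pos ha]
      simp only [List.map_cons, List.nodup_cons, dartTail_lift, List.mem_cons, not_or]
      refine ⟨⟨?_, ?_⟩, key _ _, ih _ hl.2⟩
      · cases b <;> simp
      · cases b <;> exact key _ _
    · rw [zigzag, if_neg ha]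
      simp only [List.map_cons, List.nodup_cons, dartTail_lift]
      exact ⟨key _ _, ih _ hl.2⟩

theorem sum_ite_add_eq [NeZero z] (y k : ZMod z) :
    ∑ h : ZMod z, (if h + k = y then 1 else 0) = 1 := by
  simp only [← eq_sub_iff_add_eq, Finset.sum_ite_eq', Finset.mem_univ, if_true]

theorem sum_count_lift [DecidableEq E] [DecidableEq V] [NeZero z] (e e' : E) (y k : ZMod z) :
    ∑ h : ZMod z, (if (Sum.inl (e', h + k) : (E × ZMod z) ⊕ (V × ZMod z)) = .inl (e, y)
      then 1 else 0) = if e' = e then 1 else 0 := by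
  by_cases he : e' = e
  · subst he
    simpa using sum_ite_add_eq y k
  · simp [he]

/-- The flag at a given dart does not depend on `h`, so its lifts lie at `h` plus a constant and
meet every height once. -/
theorem sum_count_inl_zigzag [DecidableEq E] [DecidableEq V] [NeZero z] (b : Bool) (l : List (E × Bool)) (e : E) (y : ZMod z) :
    ∑ h : ZMod z, occ (.inl (e, y)) ((zigzag s t S h b l).map Prod.fst) =
      occ e (l.map Prod.fst) := by
  induction l generalizing b with
  | nil => simp [zigzag]
  | cons a l ih =>
    by_cases ha : S (dartTail s t a)
    · simp only [zigzag, if_pos ha, List.map_cons, occ_cons, Finset.sum_add_distrib, ih,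
        sum_count_lift]
      simp
    · simp only [zigzag, if_neg ha, List.map_cons, occ_cons, Finset.sum_add_distrib, ih,
        sum_count_lift]

/-- In either direction the switch at a vertex of `S` uses the rung from `h` to `h + 1`, so only `h
= y` contributes. -/
theorem sum_count_inr_zigzag [DecidableEq E] [DecidableEq V] [NeZero z] (b : Bool) (l : List (E × Bool)) (v : V) (y : ZMod z) :
    ∑ h : ZMod z, occ (.inr (v, y)) ((zigzag s t S h b l).map Prod.fst) =
      if S v then occ v (l.map (dartTail s t)) else 0 := by
  induction l generalizing b with
  | nil => simp [zigzag]
  | cons a l ih =>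
    by_cases ha : S (dartTail s t a)
    · simp only [zigzag, if_pos ha, List.map_cons, occ_cons, Finset.sum_add_distrib, ih]
      by_cases hv : dartTail s t a = v
      · subst hv
        simp [ha]
      · simp [hv]
    · simp only [zigzag, if_neg ha, List.map_cons, occ_cons, Finset.sum_add_distrib, ih]
      by_cases hv : dartTail s t a = v
      · subst hv
        simp [ha]
      · simp [hv]

theorem count_some_zigzag [DecidableEq ι] (dim : E → ι) (h : ZMod z) (b : Bool) (l : List (E × Bool)) (i : ι) :
    occ (some i) ((zigzag s t S h b l).map fun a => cylDim z dim a.1) =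
      occ i (l.map fun a => dim a.1) := by
  induction l generalizing b with
  | nil => simp [zigzag]
  | cons a l ih =>
    by_cases ha : S (dartTail s t a)
    · simp [zigzag, ha, occ_cons, ih]
    · simp [zigzag, ha, occ_cons, ih]

theorem count_none_zigzag [DecidableEq ι] (dim : E → ι) (h : ZMod z) (b : Bool) (l : List (E × Bool)) :
    occ none ((zigzag s t S h b l).map fun a => cylDim z dim a.1) =
      l.countP fun a => S (dartTail s t a) := by
  induction l generalizing b with
  | nil => simp [zigzag]
  | cons a l ih =>
    by_cases ha : S (dartTail s t a)
    · simp [zigzag, ha, occ_cons, ih]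
    · simp [zigzag, ha, occ_cons, ih]

end Cylinder
-- The inductive step: adjoining a cycle factor.
section Step

variable {V E ι : Type*} {z : ℕ}

/-- A decomposition of `C_4 □ C_z` into cycles each of which uses each of the four columns of
horizontal edges `c` times, and in the first of these columns no two consecutive edges. -/
structure IsColumnDecomp (z c : ℕ) {J : Type*} [Fintype J]
    (l : J → List (((Fin 4 × ZMod z) ⊕ (Fin 4 × ZMod z)) × Bool)) : Prop
    extends IsCycleDecomp (cylSrc z (id : Fin 4 → Fin 4)) (cylTgt z (· + 1)) l where
  occ_arc : ∀ j i, occ (some i) ((l j).map fun a => cylDim z id a.1) = c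
  occ_rung : ∀ j, occ none ((l j).map fun a => cylDim z (id : Fin 4 → Fin 4) a.1) = 4 * c
  not_adj : ∀ j h, .inl (0, h) ∈ (l j).map Prod.fst → .inl (0, h + 1) ∉ (l j).map Prod.fst

/-- The walks in a cylinder that replace the edges of `C_4 □ C_z`. -/
def arcWalk (s t : E → V) (S : V → Prop) [DecidablePred S] (a : Fin 4 → E × Bool)
    (r : Fin 4 → List (E × Bool)) :
    (Fin 4 × ZMod z) ⊕ (Fin 4 × ZMod z) → List (((E × ZMod z) ⊕ (V × ZMod z)) × Bool)
  | .inl (i, h) => (.inl ((a i).1, h), (a i).2) :: zigzag s t S h false (r i)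
  | .inr (i, h) => [(.inr (dartTail s t (a i), h), true)]

/-- The inner vertices of `arcWalk`. -/
def arcInner (s t : E → V) (S : V → Prop) [DecidablePred S] (r : Fin 4 → List (E × Bool)) :
    (Fin 4 × ZMod z) ⊕ (Fin 4 × ZMod z) → List (V × ZMod z)
  | .inl (i, h) => (zigzag s t S h false (r i)).map (dartTail (cylSrc z s) (cylTgt z t))
  | .inr _ => []

theorem sum_map_finRange_eq {n : ℕ} (f : Fin n → ℕ) :
    ((List.finRange n).map f).sum = ∑ i, f i := by
  rw [← List.ofFn_eq_map, List.sum_ofFn]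

/-- Lifting a single closed walk `p`, of which the vertices in `S` are the ones where vertical edges
may be used: the edges of `C_4 □ C_z` are replaced by walks above `p`. -/
theorem IsWalk.exists_lift [NeZero z] [DecidableEq E] [DecidableEq V] [DecidableEq ι] (hz : 1 < z)
    {s t : E → V} (dim : E → ι) {u : V} {p : List (E × Bool)} (hp : IsWalk s t u p u)
    (hn : (p.map (dartTail s t)).Nodup) (S : V → Prop) [DecidablePred S] {R : ℕ} (h4 : 4 ∣ R)
    (hR : 0 < R) (hS : (p.countP fun a => S (dartTail s t a)) = R) :
    ∃ (P : (Fin 4 × ZMod z) ⊕ (Fin 4 × ZMod z) → List (((E × ZMod z) ⊕ (V × ZMod z)) × Bool))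
      (φ : Fin 4 × ZMod z → V × ZMod z)
      (I : (Fin 4 × ZMod z) ⊕ (Fin 4 × ZMod z) → List (V × ZMod z))
      (m : Fin 4 → Option ι → ℕ),
      φ.Injective ∧
      (∀ e, IsWalk (cylSrc z s) (cylTgt z t) (φ (cylSrc z id e)) (P e)
        (φ (cylTgt z (· + 1) e))) ∧
      (∀ e, (P e).map (dartTail (cylSrc z s) (cylTgt z t)) = φ (cylSrc z id e) :: I e) ∧
      (∀ e, (I e).Nodup) ∧ (∀ e v, φ v ∉ I e) ∧
      (∀ e e', e ≠ e' → (∀ h, ¬ (e = .inl (0, h) ∧ e' = .inl (0, h + 1))) →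
        (∀ h, ¬ (e' = .inl (0, h) ∧ e = .inl (0, h + 1))) → (I e).Disjoint (I e')) ∧
      (∀ e y, ∑ x, occ (.inl (e, y)) ((P x).map Prod.fst) = occ e (p.map Prod.fst)) ∧
      (∀ v y, ∑ x, occ (.inr (v, y)) ((P x).map Prod.fst) =
        if S v then occ v (p.map (dartTail s t)) else 0) ∧
      (∀ i h k, occ k ((P (.inl (i, h))).map fun a => cylDim z dim a.1) = m i k) ∧
      (∀ i h k, occ k ((P (.inr (i, h))).map fun a => cylDim z dim a.1) =
        if k = none then 1 else 0) ∧
      (∀ k, ∑ i, m i (some k) = occ k (p.map fun a => dim a.1)) ∧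
      ∑ i, m i none + 4 = R := by
  obtain ⟨a, r, hperm, hw, ha, hr⟩ := hp.exists_arcs S (by rw [hS]; exact Nat.le_of_dvd hR h4)
  have hnd : (((List.finRange 4).flatMap fun i => a i :: r i).map (dartTail s t)).Nodup :=
    ((hperm.map _).nodup_iff).2 hn
  rw [List.map_flatMap, List.nodup_flatMap] at hnd
  have hnd1 : ∀ i, dartTail s t (a i) ∉ (r i).map (dartTail s t) ∧
      ((r i).map (dartTail s t)).Nodup := fun i => by
    simpa only [List.map_cons, List.nodup_cons] using hnd.1 i (List.mem_finRange i)
  have hdis : ∀ i k, i ≠ k → ((a i :: r i).map (dartTail s t)).Disjoint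
      ((a k :: r k).map (dartTail s t)) := by
    intro i k hik
    have : Std.Symm (Function.onFun List.Disjoint
        fun i => (a i :: r i).map (dartTail s t)) := ⟨fun _ _ h => h.symm⟩
    exact hnd.2.forall (List.mem_finRange i) (List.mem_finRange k) hik
  have hvs : ∀ i k, dartTail s t (a i) = dartTail s t (a k) → i = k := by
    intro i k hik
    by_contra hne
    exact hdis i k hne (a := dartTail s t (a i)) (by simp) (by simp [hik])
  have hvr : ∀ i k, dartTail s t (a i) ∉ (r k).map (dartTail s t) := by
    intro i k hik
    by_cases h : i = k
    · subst h
      exact (hnd1 i).1 hik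
    · exact hdis i k h (a := dartTail s t (a i)) (by simp) (by
        rw [List.map_cons]
        exact List.mem_cons_of_mem _ hik)
  have hrr : ∀ i k x, x ∈ (r i).map (dartTail s t) → x ∈ (r k).map (dartTail s t) → i = k := by
    intro i k x hi hk
    by_contra h
    exact hdis i k h (a := x) (List.mem_cons_of_mem _ hi) (List.mem_cons_of_mem _ hk)
  have hcr : ∀ i, i ≠ 0 → ((r i).countP fun x => S (dartTail s t x)) = 0 := by
    intro i hi
    exact List.countP_eq_zero.2 (by simpa using hr i hi)
  have hcsum : ∑ i, ((r i).countP fun x => S (dartTail s t x)) + 4 = R := by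
    have h1 := hperm.countP_eq fun x => decide (S (dartTail s t x))
    rw [hS, List.countP_flatMap] at h1
    simp only [Function.comp_def, List.countP_cons, ha, decide_true, if_true] at h1
    rw [sum_map_finRange_eq, Finset.sum_add_distrib] at h1
    simpa using h1
  -- The first arc has `R - 4` inner vertices in `S`, an even number, and the others have none.
  -- Hence every lifted arc returns to its initial height.
  have hodd : ∀ i, ((r i).countP fun x => S (dartTail s t x)).bodd = false := by
    intro i
    by_cases hi : i = 0
    · subst hi
      rw [Finset.sum_eq_single 0 (fun i _ hi => hcr i hi) (by simp)] at hcsum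
      obtain ⟨q, rfl⟩ := h4
      rw [show ((r 0).countP fun x => S (dartTail s t x)) = 2 * (2 * q - 2) by omega,
        Nat.bodd_mul]
      rfl
    · rw [hcr i hi]
      rfl
  -- The witness for `m` counts the edges of a lifted arc by dimension: one vertical edge for each
  -- inner vertex in `S`, and the edges of the arc itself.
  refine ⟨arcWalk s t S a r, fun x => (dartTail s t (a x.1), x.2), arcInner s t S r,
    fun i k => k.elim ((r i).countP fun x => S (dartTail s t x))
      fun k => occ k ((a i :: r i).map fun x => dim x.1), ?_, ?_, ?_, ?_, ?_, ?_, ?_, ?_, ?_, ?_,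
    ?_, ?_⟩
  · rintro ⟨i, h⟩ ⟨k, h'⟩ hx
    simp only [Prod.mk.injEq] at hx
    rw [hvs _ _ hx.1, hx.2]
  · rintro (⟨i, h⟩ | ⟨i, h⟩)
    · refine ⟨dartTail_lift _ _ _ _, ?_⟩
      rw [dartHead_lift]
      have := (hw i).2.zigzag (S := S) h false
      simpa [hodd i] using this
    · exact ⟨rfl, rfl⟩
  · rintro (⟨i, h⟩ | ⟨i, h⟩)
    · simp [arcWalk, arcInner, dartTail_lift]
    · simp [arcWalk, arcInner]
  · rintro (⟨i, h⟩ | ⟨i, h⟩)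
    · exact nodup_tails_zigzag hz h false (hnd1 i).2
    · exact List.nodup_nil
  · rintro (⟨i, h⟩ | ⟨i, h⟩) v hv
    · exact hvr _ _ (mem_tails_zigzag hv).1
    · simp [arcInner] at hv
  · rintro (⟨i, h⟩ | ⟨i, h⟩) (⟨k, h'⟩ | ⟨k, h'⟩) hne h1 h2 x hx hx'
    · obtain rfl := hrr _ _ _ (mem_tails_zigzag hx).1 (mem_tails_zigzag hx').1
      -- Lifts of the first arc occupy two heights, so they can meet when these are equal or
      -- adjacent, and `h1`, `h2` exclude adjacency. Lifts of the other arcs stay at one height.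
      by_cases hi : i = 0
      · subst hi
        have e1 := (mem_tails_zigzag hx).2
        have e2 := (mem_tails_zigzag hx').2
        rcases e1 with e1 | e1 <;> rcases e2 with e2 | e2
        · exact hne (by rw [← e1, ← e2])
        · exact h2 h' ⟨rfl, by rw [← e1, ← e2]⟩
        · exact h1 h ⟨rfl, by rw [← e1, ← e2]⟩
        · exact hne (by rw [add_right_cancel (e1.symm.trans e2)])
      · exact hne (by rw [← snd_eq_of_mem_tails_zigzag (hr i hi) hx,
          ← snd_eq_of_mem_tails_zigzag (hr i hi) hx'])
    · simp [arcInner] at hx'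
    · simp [arcInner] at hx
    · simp [arcInner] at hx
  · intro e y
    rw [← occ_perm (hperm.map Prod.fst), List.map_flatMap, occ_flatMap, sum_map_finRange_eq,
      Fintype.sum_sum_type, Fintype.sum_prod_type]
    simp only [arcWalk, List.map_cons, occ_cons, Finset.sum_add_distrib, sum_count_inl_zigzag,
      List.map_nil, occ_nil]
    have := fun i => sum_count_lift (V := V) e (a i).1 y 0
    simp only [add_zero] at this
    simp only [this, reduceCtorEq, if_false, Finset.sum_const_zero, add_zero]
  · intro v y
    rw [← occ_perm (hperm.map (dartTail s t)), List.map_flatMap, occ_flatMap, sum_map_finRange_eq,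
      Fintype.sum_sum_type, Fintype.sum_prod_type, Fintype.sum_prod_type]
    simp only [arcWalk, List.map_cons, occ_cons, Finset.sum_add_distrib, sum_count_inr_zigzag,
      List.map_nil, occ_nil]
    by_cases hv : S v
    · simp only [hv, if_true, reduceCtorEq, if_false, Finset.sum_const_zero, add_zero, zero_add,
        Sum.inr.injEq, Prod.mk.injEq]
      congr 1
      refine Finset.sum_congr rfl fun i _ => ?_
      by_cases hi : dartTail s t (a i) = v <;> simp [hi]
    · have : ∀ i, dartTail s t (a i) ≠ v := fun i hi => hv (hi ▸ ha i)
      simp [hv, this]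
  · rintro i h (_ | k)
    · simp [arcWalk, occ_cons, count_none_zigzag]
    · simp [arcWalk, occ_cons, count_some_zigzag]
  · rintro i h (_ | k)
    · simp [arcWalk, occ_cons]
    · simp [arcWalk, occ_cons]
  · intro k
    rw [← occ_perm (hperm.map fun a => dim a.1), List.map_flatMap, occ_flatMap,
      sum_map_finRange_eq]
    rfl
  · exact hcsum

theorem HasBalancedDecomp.cyl [Fintype V] [DecidableEq V] [Fintype E] [DecidableEq E]
    [Fintype ι] [DecidableEq ι] [Nonempty ι] [NeZero z] (hz : 1 < z) {s t : E → V} {dim : E → ι}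
    {R c : ℕ} (h : HasBalancedDecomp s t dim R) (h4 : 4 ∣ R) (hR : 0 < R)
    (hs : ∀ v, (Finset.univ.filter fun e => s e = v).card = Fintype.card ι)
    (ht : ∀ v, (Finset.univ.filter fun e => t e = v).card = Fintype.card ι)
    {J₀ : Type} [Fintype J₀] {l₀ : J₀ → List (((Fin 4 × ZMod z) ⊕ (Fin 4 × ZMod z)) × Bool)}
    (h₀ : IsColumnDecomp z c l₀) :
    HasBalancedDecomp (cylSrc z s) (cylTgt z t) (cylDim z dim) (c * R) := by
  classical
  obtain ⟨J, _, l, hl, hc⟩ := h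
  obtain ⟨f, hf, hfR⟩ := hl.exists_assignment hR hs ht hc
  choose u hu using hl.closed
  have hS : ∀ j, ((l j).countP fun a => f (dartTail s t a) = j) = R := by
    intro j
    rw [← hfR j]
    have h1 : ((l j).countP fun a => f (dartTail s t a) = j) =
        (((l j).map (dartTail s t)).filter fun v => f v = j).length := by
      rw [← List.countP_eq_length_filter, List.countP_map]
      rfl
    rw [h1, ← List.toFinset_card_of_nodup ((hl.nodup j).filter _)]
    congr 1
    ext v
    simp only [List.mem_toFinset, List.mem_filter, decide_eq_true_eq, Finset.mem_filter,
      Finset.mem_univ, true_and, and_iff_right_iff_imp]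
    rintro rfl
    exact hf v
  choose P φ I m hφ hP hI hIn hIφ hd hcl hcr hml hmr hms hmn using
    fun j => (hu j).exists_lift hz dim (hl.nodup j) (fun v => f v = j) h4 hR (hS j)
  refine ⟨J × J₀, inferInstance, fun x => (l₀ x.2).flatMap (expand (P x.1)), ⟨?_, ?_, ?_⟩, ?_⟩
  · rintro ⟨j, g⟩
    obtain ⟨v, hv⟩ := h₀.closed g
    exact ⟨_, isWalk_flatMap_expand (hP j) hv⟩
  · rintro ⟨j, g⟩
    refine nodup_tails_flatMap_expand (hφ j) (hP j) (hI j) (hIn j) (hIφ j) (h₀.nodup g)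
      (h₀.nodup_edges g) fun e he e' he' hne => hd j e e' hne ?_ ?_
    · rintro h ⟨rfl, rfl⟩
      exact h₀.not_adj g h he he'
    · rintro h ⟨rfl, rfl⟩
      exact h₀.not_adj g h he' he
  · intro x
    have h1 : ∀ j, ∑ g, occ x (((l₀ g).flatMap (expand (P j))).map Prod.fst) =
        ∑ e, occ x ((P j e).map Prod.fst) := by
      intro j
      rw [← h₀.sum_sum_map]
      refine Finset.sum_congr rfl fun g _ => ?_
      rw [List.map_flatMap, occ_flatMap]
      simp only [occ_perm (map_fst_expand _ _)]
    rw [Fintype.sum_prod_type]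
    simp only [h1]
    rcases x with ⟨e, y⟩ | ⟨v, y⟩
    · simp only [hcl, hl.cover]
    · simp only [hcr]
      -- A vertical edge above `v` is used only by lifts of the cycle `f v`.
      rw [Finset.sum_ite_eq, if_pos (Finset.mem_univ _)]
      exact occ_eq_one (hl.nodup _) (hf v)
  · rintro ⟨j, g⟩ k
    have h1 : ∀ a, occ k ((expand (P j) a).map fun a => cylDim z dim a.1) =
        occ k ((P j a.1).map fun a => cylDim z dim a.1) := by
      intro a
      have := (map_fst_expand (P j) a).map (cylDim z dim)
      simp only [List.map_map] at this
      exact occ_perm this k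
    have h2 : ∀ e, occ k ((P j e).map fun a => cylDim z dim a.1) =
        (cylDim z (id : Fin 4 → Fin 4) e).elim (if k = none then 1 else 0) fun i => m j i k := by
      rintro (⟨i, h⟩ | ⟨i, h⟩)
      · rw [hml]
        rfl
      · rw [hmr]
        rfl
    simp only [List.map_flatMap, occ_flatMap, h1, h2]
    -- The count depends only on the column of each substituted edge, and every cycle has `c` edges
    -- in each column and `4 * c` rungs.
    rw [sum_map_comp_eq (fun a : ((Fin 4 × ZMod z) ⊕ (Fin 4 × ZMod z)) × Bool => cylDim z id a.1)
      (fun o => o.elim (if k = none then 1 else 0) fun i => m j i k), Fintype.sum_option]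
    simp only [h₀.occ_arc, h₀.occ_rung, Option.elim, ← Finset.mul_sum]
    rcases k with _ | k
    · rw [← hmn j]
      simp
      ring
    · rw [hms, hc]
      simp

end Step
-- Decompositions of `C_4 □ C_z`: the cases `c = 1` and `2 * c = z`.
section Columns

variable {z : ℕ}

/-- Each closed walk has `8 * c` edges, so together they have `8 * z`, the number of edges of `C_4 □
C_z`. A family that covers all edges therefore uses each of them once. -/
theorem IsColumnDecomp.of_surjective {J : Type*} [Fintype J] [NeZero z] {c : ℕ}
    {l : J → List (((Fin 4 × ZMod z) ⊕ (Fin 4 × ZMod z)) × Bool)}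
    (hJ : Fintype.card J * c = z)
    (closed : ∀ j, ∃ u, IsWalk (cylSrc z (id : Fin 4 → Fin 4)) (cylTgt z (· + 1)) u (l j) u)
    (nodup : ∀ j, ((l j).map (dartTail (cylSrc z (id : Fin 4 → Fin 4)) (cylTgt z (· + 1)))).Nodup)
    (occ_arc : ∀ j i, occ (some i) ((l j).map fun a => cylDim z id a.1) = c)
    (occ_rung : ∀ j, occ none ((l j).map fun a => cylDim z (id : Fin 4 → Fin 4) a.1) = 4 * c)
    (not_adj : ∀ j h, .inl (0, h) ∈ (l j).map Prod.fst → .inl (0, h + 1) ∉ (l j).map Prod.fst)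
    (mem : ∀ e, ∃ j, e ∈ (l j).map Prod.fst) : IsColumnDecomp z c l := by
  refine ⟨⟨closed, nodup, ?_⟩, occ_arc, occ_rung, not_adj⟩
  have hlen : ∀ j, (l j).length = 8 * c := by
    intro j
    have := sum_occ_eq_length ((l j).map fun a => cylDim z (id : Fin 4 → Fin 4) a.1)
    rw [Fintype.sum_option] at this
    simp only [occ_arc, occ_rung, List.length_map, Finset.sum_const, Finset.card_univ,
      Fintype.card_fin, smul_eq_mul] at this
    omega
  have hsum : ∑ e, ∑ j, occ e ((l j).map Prod.fst) =
      ∑ _e : (Fin 4 × ZMod z) ⊕ (Fin 4 × ZMod z), 1 := by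
    rw [Finset.sum_comm]
    simp only [sum_occ_eq_length, List.length_map, hlen, Finset.sum_const, Finset.card_univ,
      smul_eq_mul, Fintype.card_sum, Fintype.card_prod, Fintype.card_fin, ZMod.card, mul_one]
    calc Fintype.card J * (8 * c) = 8 * (Fintype.card J * c) := by ring
      _ = 4 * z + 4 * z := by rw [hJ]; ring
  have hle : ∀ e ∈ Finset.univ, 1 ≤ ∑ j, occ e ((l j).map Prod.fst) := by
    intro e _
    obtain ⟨j, hj⟩ := mem e
    exact (occ_pos.2 hj).trans_le (Finset.single_le_sum
      (f := fun j => occ e ((l j).map Prod.fst)) (fun _ _ => Nat.zero_le _) (Finset.mem_univ j))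
  intro e
  exact ((Finset.sum_eq_sum_iff_of_le hle).1 hsum.symm e (Finset.mem_univ e)).symm

/-- The horizontal dart from `(i, n)` to `(i + 1, n)`. -/
def right (z : ℕ) (i : Fin 4) (n : ℕ) : ((Fin 4 × ZMod z) ⊕ (Fin 4 × ZMod z)) × Bool :=
  (.inl (i, n), true)

/-- The vertical dart from `(i, n)` to `(i, n + 1)`. -/
def up (z : ℕ) (i : Fin 4) (n : ℕ) : ((Fin 4 × ZMod z) ⊕ (Fin 4 × ZMod z)) × Bool :=
  (.inr (i, n), true)

/-- The vertical dart from `(i, n + 1)` to `(i, n)`. -/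
def down (z : ℕ) (i : Fin 4) (n : ℕ) : ((Fin 4 × ZMod z) ⊕ (Fin 4 × ZMod z)) × Bool :=
  (.inr (i, n), false)

/-- The start of a dart of `C_4 □ C_z`. -/
abbrev colTail (z : ℕ) : ((Fin 4 × ZMod z) ⊕ (Fin 4 × ZMod z)) × Bool → Fin 4 × ZMod z :=
  dartTail (cylSrc z id) (cylTgt z (· + 1))

/-- The end of a dart of `C_4 □ C_z`. -/
abbrev colHead (z : ℕ) : ((Fin 4 × ZMod z) ⊕ (Fin 4 × ZMod z)) × Bool → Fin 4 × ZMod z :=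
  dartTail (cylTgt z (· + 1)) (cylSrc z id)

theorem colTail_right (i : Fin 4) (n : ℕ) : colTail z (right z i n) = (i, (n : ZMod z)) := rfl
theorem colHead_right (i : Fin 4) (n : ℕ) : colHead z (right z i n) = (i + 1, (n : ZMod z)) := rfl
theorem colTail_up (i : Fin 4) (n : ℕ) : colTail z (up z i n) = (i, (n : ZMod z)) := rfl
theorem colHead_up (i : Fin 4) (n : ℕ) :
    colHead z (up z i n) = (i, ((n + 1 : ℕ) : ZMod z)) := by
  simp [colHead, up]
theorem colTail_down (i : Fin 4) (n : ℕ) :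
    colTail z (down z i n) = (i, ((n + 1 : ℕ) : ZMod z)) := by
  simp [colTail, down]
theorem colHead_down (i : Fin 4) (n : ℕ) : colHead z (down z i n) = (i, (n : ZMod z)) := rfl

/-- Each cycle runs between two consecutive heights. -/
theorem exists_columnDecomp_one (hz : 1 < z) :
    ∃ (J : Type) (_ : Fintype J) (l : J → List (((Fin 4 × ZMod z) ⊕ (Fin 4 × ZMod z)) × Bool)),
      IsColumnDecomp z 1 l := by
  have : NeZero z := ⟨by omega⟩
  have : Fact (1 < z) := ⟨hz⟩
  refine ⟨ZMod z, inferInstance, fun h => [(.inl (0, h), true), (.inr (1, h), true),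
    (.inl (1, h + 1), true), (.inr (2, h), false), (.inl (2, h), true), (.inr (3, h), true),
    (.inl (3, h + 1), true), (.inr (0, h), false)],
    IsColumnDecomp.of_surjective (by simp) ?_ ?_ ?_ ?_ ?_ ?_⟩
  · intro h
    exact ⟨(0, h), by simp [IsWalk]⟩
  · intro h
    simp
  · intro h i
    fin_cases i <;> simp [occ_cons]
  · intro h
    simp [occ_cons]
  · intro h h'
    simp +contextual
  · rintro (⟨i, h⟩ | ⟨i, h⟩)
    · fin_cases i
      · exact ⟨h, by simp⟩
      · exact ⟨h - 1, by simp⟩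
      · exact ⟨h, by simp⟩
      · exact ⟨h - 1, by simp⟩
    · exact ⟨h, by fin_cases i <;> simp⟩

theorem natCast_mod_two_eq (hz : 2 ∣ z) {a b : ℕ} (h : (a : ZMod z) = b) : a % 2 = b % 2 :=
  ((ZMod.natCast_eq_natCast_iff a b z).1 h).of_dvd hz

theorem natCast_inj_of_lt {a b : ℕ} (ha : a < z) (hb : b < z) (h : (a : ZMod z) = b) : a = b :=
  ((ZMod.natCast_eq_natCast_iff a b z).1 h).eq_of_lt_of_lt ha hb

theorem val_three_fin_four : ((3 : Fin 4) : ℕ) = 3 := rfl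

/-- One turn of a spiral that climbs by two. -/
def spiralTurn (z n : ℕ) : List (((Fin 4 × ZMod z) ⊕ (Fin 4 × ZMod z)) × Bool) :=
  [right z 0 n, up z 1 n, right z 1 (n + 1), up z 2 (n + 1), right z 2 (n + 2), up z 3 (n + 2),
    right z 3 (n + 3), down z 0 (n + 2)]

theorem tails_spiralTurn (n : ℕ) : (spiralTurn z n).map (colTail z) =
    ([(0, n), (1, n), (1, n + 1), (2, n + 1), (2, n + 2), (3, n + 2), (3, n + 3),
      (0, n + 3)] : List (Fin 4 × ℕ)).map fun x => (x.1, (x.2 : ZMod z)) := by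
  simp [spiralTurn, colTail_right, colTail_up, colTail_down, add_assoc]

/-- Two spirals start at heights 0 and 1 and climb by two per turn, so they close up after `c`
turns. Each uses column 0 only at heights of one parity, which is meaningful because `z` is even. -/
theorem exists_columnDecomp_half {c : ℕ} (hc : 0 < c) (hz : 2 * c = z) :
    ∃ (J : Type) (_ : Fintype J) (l : J → List (((Fin 4 × ZMod z) ⊕ (Fin 4 × ZMod z)) × Bool)),
      IsColumnDecomp z c l := by
  have : NeZero z := ⟨by omega⟩
  have h2 : 2 ∣ z := ⟨c, hz.symm⟩
  refine ⟨Fin 2, inferInstance, fun g => (List.range c).flatMap fun k => spiralTurn z (g + 2 * k),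
    IsColumnDecomp.of_surjective (by simpa using hz) ?_ ?_ ?_ ?_ ?_ ?_⟩
  · intro g
    refine ⟨(0, ((g : ℕ) : ZMod z)), ?_⟩
    have := isWalk_flatMap_range (s := cylSrc z (id : Fin 4 → Fin 4)) (t := cylTgt z (· + 1))
      (fun k => ((0 : Fin 4), (((g : ℕ) + 2 * k : ℕ) : ZMod z)))
      (fun k => spiralTurn z (g + 2 * k)) c ?_
    · rw [hz] at this
      simpa using this
    · intro k _
      simp only [spiralTurn, IsWalk]
      simp only [colTail_right, colTail_up, colTail_down,
        colHead_right, colHead_up, colHead_down]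
      simp [mul_add, add_assoc]
  · intro g
    rw [List.map_flatMap, List.nodup_flatMap]
    constructor
    · intro k _
      rw [tails_spiralTurn]
      refine List.Nodup.map_on ?_ (by simp)
      rintro ⟨i, a⟩ ha ⟨i', b⟩ hb hab
      simp only [Prod.mk.injEq] at hab
      obtain ⟨rfl, hab⟩ := hab
      -- The two vertices of a turn in the same column have heights of different parity.
      have := natCast_mod_two_eq h2 hab
      simp only [List.mem_cons, Prod.mk.injEq, List.not_mem_nil, or_false, Fin.ext_iff,
        Fin.val_zero, Fin.val_one, Fin.val_two, val_three_fin_four] at ha hb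
      rw [Prod.mk.injEq]
      refine ⟨rfl, ?_⟩
      omega
    · refine List.Pairwise.imp_of_mem ?_ (List.nodup_range (n := c))
      intro k k' hk hk' hne x hx hx'
      rw [List.mem_range] at hk hk'
      beta_reduce at hx hx'
      rw [tails_spiralTurn] at hx hx'
      obtain ⟨⟨i, a⟩, ha, rfl⟩ := List.mem_map.1 hx
      obtain ⟨⟨i', b⟩, hb, hab⟩ := List.mem_map.1 hx'
      simp only [Prod.mk.injEq] at hab
      obtain ⟨rfl, hab⟩ := hab
      have h3 := natCast_mod_two_eq h2 hab
      simp only [List.mem_cons, Prod.mk.injEq, List.not_mem_nil, or_false, Fin.ext_iff,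
        Fin.val_zero, Fin.val_one, Fin.val_two, val_three_fin_four] at ha hb
      -- Column and parity determine the position within a turn, so both vertices have the same
      -- offset `o`.
      obtain ⟨o, rfl, rfl⟩ : ∃ o, a = g + 2 * k + o ∧ b = g + 2 * k' + o := by
        refine ⟨a - (g + 2 * k), ?_, ?_⟩ <;> omega
      have h4 : ((2 * k : ℕ) : ZMod z) = ((2 * k' : ℕ) : ZMod z) := by
        push_cast at hab ⊢
        simpa using hab.symm
      have := natCast_inj_of_lt (by omega) (by omega) h4
      omega
  · intro g i
    simp only [List.map_flatMap, occ_flatMap]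
    fin_cases i <;> simp [spiralTurn, occ_cons, right, up, down]
  · intro g
    simp only [List.map_flatMap, occ_flatMap]
    simp [spiralTurn, occ_cons, right, up, down, mul_comm]
  · intro g h hm hm'
    simp only [List.map_flatMap, List.mem_flatMap, List.mem_range] at hm hm'
    obtain ⟨k, _, hm⟩ := hm
    obtain ⟨k', _, hm'⟩ := hm'
    simp [spiralTurn, right, up, down] at hm hm'
    rw [hm] at hm'
    have := natCast_mod_two_eq (a := g + 2 * k + 1) (b := g + 2 * k') h2 (by exact_mod_cast hm')
    omega
  · have key : ∀ (y : ZMod z) (o : ℕ), ∃ g : Fin 2, ∃ k < c, ((g + 2 * k + o : ℕ) : ZMod z) = y := by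
      intro y o
      refine ⟨⟨(y - o).val % 2, Nat.mod_lt _ two_pos⟩, (y - o).val / 2, ?_, ?_⟩
      · have := (y - o).val_lt
        omega
      · rw [Nat.cast_add, Nat.mod_add_div, ZMod.natCast_zmod_val, sub_add_cancel]
    rintro (⟨i, y⟩ | ⟨i, y⟩)
    · obtain ⟨g, k, hk, rfl⟩ := key y i
      refine ⟨g, ?_⟩
      rw [List.map_flatMap, List.mem_flatMap]
      refine ⟨k, List.mem_range.2 hk, ?_⟩
      fin_cases i <;> simp [spiralTurn, right, up, down]
    -- The entries are the offsets in `spiralTurn` of the rungs in columns 0, 1, 2, 3.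
    · obtain ⟨g, k, hk, rfl⟩ := key y (![2, 0, 1, 2] i)
      refine ⟨g, ?_⟩
      rw [List.map_flatMap, List.mem_flatMap]
      refine ⟨k, List.mem_range.2 hk, ?_⟩
      fin_cases i <;> simp [spiralTurn, right, up, down]

end Columns
-- Decompositions of `C_4 □ C_z`: even `c` with `2 * c < z`.
section Helix

variable {z : ℕ}

/-- One turn of a staircase that climbs by four. -/
def helixTurn (z n : ℕ) : List (((Fin 4 × ZMod z) ⊕ (Fin 4 × ZMod z)) × Bool) :=
  [right z 0 n, up z 1 n, right z 1 (n + 1), up z 2 (n + 1), right z 2 (n + 2), up z 3 (n + 2),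
    right z 3 (n + 3), up z 0 (n + 3)]

/-- A staircase from `(0, 0)` to `(0, 4 * (f + 1))`. -/
def helixOne (z f : ℕ) : List (((Fin 4 × ZMod z) ⊕ (Fin 4 × ZMod z)) × Bool) :=
  (List.range (f + 1)).flatMap fun k => helixTurn z (4 * k)

/-- A second staircase from `(0, 0)` to `(0, 4 * (f + 1))`. -/
def helixTwo (z f : ℕ) : List (((Fin 4 × ZMod z) ⊕ (Fin 4 × ZMod z)) × Bool) :=
  [up z 0 0, up z 0 1] ++ ((List.range f).flatMap fun k => helixTurn z (4 * k + 2)) ++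
    [right z 0 (4 * f + 2), up z 1 (4 * f + 2), right z 1 (4 * f + 3), up z 2 (4 * f + 3),
      right z 2 (4 * f + 4), right z 3 (4 * f + 4)]

/-- The cycle that consists of the two staircases. -/
def helix (z f : ℕ) : List (((Fin 4 × ZMod z) ⊕ (Fin 4 × ZMod z)) × Bool) :=
  helixOne z f ++ revWalk (helixTwo z f)

theorem isWalk_helixTurn (n : ℕ) :
    IsWalk (cylSrc z (id : Fin 4 → Fin 4)) (cylTgt z (· + 1)) (0, (n : ZMod z)) (helixTurn z n)
      (0, ((n + 4 : ℕ) : ZMod z)) := by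
  simp only [helixTurn, IsWalk, colTail_right, colTail_up, colHead_right, colHead_up]
  simp

theorem isWalk_helixOne (f : ℕ) :
    IsWalk (cylSrc z (id : Fin 4 → Fin 4)) (cylTgt z (· + 1)) (0, 0) (helixOne z f)
      (0, ((4 * f + 4 : ℕ) : ZMod z)) := by
  have := isWalk_flatMap_range (s := cylSrc z (id : Fin 4 → Fin 4)) (t := cylTgt z (· + 1))
      (fun k => ((0 : Fin 4), ((4 * k : ℕ) : ZMod z))) (fun k => helixTurn z (4 * k)) (f + 1)
      fun k _ => isWalk_helixTurn _
  simpa [mul_add, helixOne] using this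

theorem isWalk_helixTwo (f : ℕ) :
    IsWalk (cylSrc z (id : Fin 4 → Fin 4)) (cylTgt z (· + 1)) (0, 0) (helixTwo z f)
      (0, ((4 * f + 4 : ℕ) : ZMod z)) := by
  have := isWalk_flatMap_range (s := cylSrc z (id : Fin 4 → Fin 4)) (t := cylTgt z (· + 1))
      (fun k => ((0 : Fin 4), ((4 * k + 2 : ℕ) : ZMod z))) (fun k => helixTurn z (4 * k + 2)) f
      fun k _ => isWalk_helixTurn _
  refine (IsWalk.append (v := (0, ((4 * 0 + 2 : ℕ) : ZMod z))) ?_ this).append ?_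
  · simp only [IsWalk, colTail_up, colHead_up]
    simp
  · simp only [IsWalk, colTail_right, colTail_up, colHead_right, colHead_up]
    simp

theorem isWalk_helix (f : ℕ) :
    IsWalk (cylSrc z (id : Fin 4 → Fin 4)) (cylTgt z (· + 1)) (0, 0) (helix z f) (0, 0) :=
  (isWalk_helixOne f).append (isWalk_helixTwo f).rev

theorem tails_helixTurn (n : ℕ) : (helixTurn z n).map (colTail z) =
    ([(0, n), (1, n), (1, n + 1), (2, n + 1), (2, n + 2), (3, n + 2), (3, n + 3),
      (0, n + 3)] : List (Fin 4 × ℕ)).map fun x => (x.1, (x.2 : ZMod z)) := by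
  simp [helixTurn, colTail_right, colTail_up]

theorem heads_helixTurn (n : ℕ) : (helixTurn z n).map (colHead z) =
    ([(1, n), (1, n + 1), (2, n + 1), (2, n + 2), (3, n + 2), (3, n + 3),
      (0, n + 3), (0, n + 4)] : List (Fin 4 × ℕ)).map fun x => (x.1, (x.2 : ZMod z)) := by
  simp [helixTurn, colHead_right, colHead_up, add_assoc]

theorem nodup_map_natCast {L : List (Fin 4 × ℕ)} (hL : L.Nodup) (hz : ∀ x ∈ L, x.2 < z) :
    (L.map fun x => (x.1, (x.2 : ZMod z))).Nodup := by
  refine List.Nodup.map_on (fun x hx y hy hxy => ?_) hL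
  rw [Prod.mk.injEq] at hxy
  exact Prod.ext hxy.1 (natCast_inj_of_lt (hz x hx) (hz y hy) hxy.2)

/-- All heights lie between 0 and `4 * f + 4`, so distinctness can be checked in `ℕ`. In each column
the two staircases occupy different residues modulo 4, except for the common top vertex, which is
listed once. Heads of `helixTwo` appear because it is traversed backwards. -/
theorem nodup_tails_helix {f : ℕ} (hz : 4 * f + 4 < z) :
    ((helix z f).map (colTail z)).Nodup := by
  have e1 : (helixOne z f).map (colTail z) = ((List.range (f + 1)).flatMap fun k =>
      ([(0, 4 * k), (1, 4 * k), (1, 4 * k + 1), (2, 4 * k + 1), (2, 4 * k + 2), (3, 4 * k + 2),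
        (3, 4 * k + 3), (0, 4 * k + 3)] : List (Fin 4 × ℕ))).map
        fun x => (x.1, (x.2 : ZMod z)) := by
    simp only [helixOne, List.map_flatMap, tails_helixTurn]
  have e2 : (helixTwo z f).map (colHead z) = (([(0, 1), (0, 2)] : List (Fin 4 × ℕ)) ++
      ((List.range f).flatMap fun k => ([(1, 4 * k + 2), (1, 4 * k + 3), (2, 4 * k + 3),
        (2, 4 * k + 4), (3, 4 * k + 4), (3, 4 * k + 5), (0, 4 * k + 5), (0, 4 * k + 6)] :
          List (Fin 4 × ℕ))) ++ [(1, 4 * f + 2), (1, 4 * f + 3), (2, 4 * f + 3), (2, 4 * f + 4),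
          (3, 4 * f + 4), (0, 4 * f + 4)]).map fun x : Fin 4 × ℕ => (x.1, (x.2 : ZMod z)) := by
    simp [helixTwo, List.map_flatMap, heads_helixTurn, colHead_right, colHead_up, add_assoc]
  rw [helix, List.map_append, map_tail_revWalk, e1, e2, ← List.map_reverse, ← List.map_append]
  have m1 : ∀ i : Fin 4, ∀ n k, (i, n) ∈ ([(0, 4 * k), (1, 4 * k), (1, 4 * k + 1), (2, 4 * k + 1),
      (2, 4 * k + 2), (3, 4 * k + 2), (3, 4 * k + 3), (0, 4 * k + 3)] : List (Fin 4 × ℕ)) →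
      ((i : ℕ) = 0 ∧ (n = 4 * k ∨ n = 4 * k + 3)) ∨ ((i : ℕ) = 1 ∧ (n = 4 * k ∨ n = 4 * k + 1)) ∨
      ((i : ℕ) = 2 ∧ (n = 4 * k + 1 ∨ n = 4 * k + 2)) ∨
      ((i : ℕ) = 3 ∧ (n = 4 * k + 2 ∨ n = 4 * k + 3)) := by
    intro i n k h
    simp only [List.mem_cons, Prod.mk.injEq, List.not_mem_nil, or_false, Fin.ext_iff,
      Fin.val_zero, Fin.val_one, Fin.val_two, val_three_fin_four] at h
    omega
  have m2 : ∀ i : Fin 4, ∀ n k, (i, n) ∈ ([(1, 4 * k + 2), (1, 4 * k + 3), (2, 4 * k + 3),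
      (2, 4 * k + 4), (3, 4 * k + 4), (3, 4 * k + 5), (0, 4 * k + 5), (0, 4 * k + 6)] :
        List (Fin 4 × ℕ)) →
      ((i : ℕ) = 0 ∧ (n = 4 * k + 5 ∨ n = 4 * k + 6)) ∨
      ((i : ℕ) = 1 ∧ (n = 4 * k + 2 ∨ n = 4 * k + 3)) ∨
      ((i : ℕ) = 2 ∧ (n = 4 * k + 3 ∨ n = 4 * k + 4)) ∨
      ((i : ℕ) = 3 ∧ (n = 4 * k + 4 ∨ n = 4 * k + 5)) := by
    intro i n k h
    simp only [List.mem_cons, Prod.mk.injEq, List.not_mem_nil, or_false, Fin.ext_iff,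
      Fin.val_zero, Fin.val_one, Fin.val_two, val_three_fin_four] at h
    omega
  have m3 : ∀ i : Fin 4, ∀ n, (i, n) ∈ ([(0, 1), (0, 2)] : List (Fin 4 × ℕ)) →
      (i : ℕ) = 0 ∧ (n = 1 ∨ n = 2) := by
    intro i n h
    simp only [List.mem_cons, Prod.mk.injEq, List.not_mem_nil, or_false, Fin.ext_iff,
      Fin.val_zero] at h
    omega
  have m4 : ∀ i : Fin 4, ∀ n, (i, n) ∈ ([(1, 4 * f + 2), (1, 4 * f + 3), (2, 4 * f + 3),
      (2, 4 * f + 4), (3, 4 * f + 4), (0, 4 * f + 4)] : List (Fin 4 × ℕ)) →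
      ((i : ℕ) = 0 ∧ n = 4 * f + 4) ∨ ((i : ℕ) = 1 ∧ (n = 4 * f + 2 ∨ n = 4 * f + 3)) ∨
      ((i : ℕ) = 2 ∧ (n = 4 * f + 3 ∨ n = 4 * f + 4)) ∨ ((i : ℕ) = 3 ∧ n = 4 * f + 4) := by
    intro i n h
    simp only [List.mem_cons, Prod.mk.injEq, List.not_mem_nil, or_false, Fin.ext_iff,
      Fin.val_zero, Fin.val_one, Fin.val_two, val_three_fin_four] at h
    omega
  refine nodup_map_natCast ?_ ?_
  · refine List.nodup_append'.2 ⟨?_, ?_, ?_⟩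
    · refine List.nodup_flatMap.2 ⟨fun k _ => by simp, ?_⟩
      refine List.Pairwise.imp_of_mem ?_ (List.nodup_range (n := f + 1))
      rintro k k' _ _ hne ⟨i, n⟩ hx hx'
      have h1 := m1 _ _ _ hx
      have h2 := m1 _ _ _ hx'
      omega
    · rw [List.nodup_reverse]
      refine List.nodup_append'.2 ⟨List.nodup_append'.2 ⟨by simp, ?_, ?_⟩, by simp, ?_⟩
      · refine List.nodup_flatMap.2 ⟨fun k _ => by simp, ?_⟩
        refine List.Pairwise.imp_of_mem ?_ (List.nodup_range (n := f))
        rintro k k' _ _ hne ⟨i, n⟩ hx hx'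
        have h1 := m2 _ _ _ hx
        have h2 := m2 _ _ _ hx'
        omega
      · rintro ⟨i, n⟩ hx hx'
        obtain ⟨k, hk, hx'⟩ := List.mem_flatMap.1 hx'
        have h1 := m3 _ _ hx
        have h2 := m2 _ _ _ hx'
        omega
      · rintro ⟨i, n⟩ hx hx'
        have h2 := m4 _ _ hx'
        rcases List.mem_append.1 hx with hx | hx
        · have h1 := m3 _ _ hx
          omega
        · obtain ⟨k, hk, hx⟩ := List.mem_flatMap.1 hx
          rw [List.mem_range] at hk
          have h1 := m2 _ _ _ hx
          omega
    · rintro ⟨i, n⟩ hx hx'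
      obtain ⟨k, hk, hx⟩ := List.mem_flatMap.1 hx
      rw [List.mem_range] at hk
      have h1 := m1 _ _ _ hx
      rw [List.mem_reverse] at hx'
      rcases List.mem_append.1 hx' with hx' | hx'
      · rcases List.mem_append.1 hx' with hx' | hx'
        · have := m3 _ _ hx'
          omega
        · obtain ⟨k', hk', hx'⟩ := List.mem_flatMap.1 hx'
          have := m2 _ _ _ hx'
          omega
      · have := m4 _ _ hx'
        omega
  · rintro ⟨i, n⟩ hx
    rcases List.mem_append.1 hx with hx | hx
    · obtain ⟨k, hk, hx⟩ := List.mem_flatMap.1 hx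
      rw [List.mem_range] at hk
      have := m1 _ _ _ hx
      simp only
      omega
    · rw [List.mem_reverse] at hx
      rcases List.mem_append.1 hx with hx | hx
      · rcases List.mem_append.1 hx with hx | hx
        · have := m3 _ _ hx
          simp only
          omega
        · obtain ⟨k, hk, hx⟩ := List.mem_flatMap.1 hx
          rw [List.mem_range] at hk
          have := m2 _ _ _ hx
          simp only
          omega
      · have := m4 _ _ hx
        simp only
        omega

theorem occ_map_of_injective {α β : Type*} [DecidableEq α] [DecidableEq β] {g : α → β}
    (hg : g.Injective) (a : α) (l : List α) : occ (g a) (l.map g) = occ a l := by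
  induction l with
  | nil => simp
  | cons b l ih => simp [occ_cons, ih, hg.eq_iff]

theorem occ_dim_helix (f : ℕ) (o : Option (Fin 4)) :
    occ o ((helix z f).map fun a => cylDim z id a.1) =
      occ o ((helixOne z f).map fun a => cylDim z id a.1) +
        occ o ((helixTwo z f).map fun a => cylDim z id a.1) := by
  rw [helix, List.map_append, occ_append]
  congr 1
  have := (map_fst_revWalk (helixTwo z f)).map (cylDim z (id : Fin 4 → Fin 4))
  simp only [List.map_map] at this
  exact occ_perm this o

theorem occ_some_helix (f : ℕ) (i : Fin 4) :
    occ (some i) ((helix z f).map fun a => cylDim z id a.1) = 2 * (f + 1) := by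
  rw [occ_dim_helix]
  simp only [helixOne, helixTwo, List.map_append, occ_append, List.map_flatMap, occ_flatMap]
  fin_cases i <;> simp [helixTurn, occ_cons, right, up] <;> ring

theorem occ_none_helix (f : ℕ) :
    occ none ((helix z f).map fun a => cylDim z (id : Fin 4 → Fin 4) a.1) =
      4 * (2 * (f + 1)) := by
  rw [occ_dim_helix]
  simp only [helixOne, helixTwo, List.map_append, occ_append, List.map_flatMap, occ_flatMap]
  simp [helixTurn, occ_cons, right, up]
  ring

theorem mem_helix_iff (f : ℕ) (x : (Fin 4 × ZMod z) ⊕ (Fin 4 × ZMod z)) :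
    x ∈ (helix z f).map Prod.fst ↔
      (∃ k < f + 1, x ∈ (helixTurn z (4 * k)).map Prod.fst) ∨
      x ∈ ([up z 0 0, up z 0 1].map Prod.fst) ∨
      (∃ k < f, x ∈ (helixTurn z (4 * k + 2)).map Prod.fst) ∨
      x ∈ ([right z 0 (4 * f + 2), up z 1 (4 * f + 2), right z 1 (4 * f + 3), up z 2 (4 * f + 3),
        right z 2 (4 * f + 4), right z 3 (4 * f + 4)].map Prod.fst) := by
  rw [helix, List.map_append, List.mem_append, (map_fst_revWalk _).mem_iff, helixOne, helixTwo,
    List.map_append, List.map_append, List.mem_append, List.mem_append, List.map_flatMap,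
    List.map_flatMap, List.mem_flatMap, List.mem_flatMap, or_assoc]
  simp only [List.mem_range]

theorem arc_mem_helixTurn (i : Fin 4) (n : ℕ) :
    .inl (i, ((n + i : ℕ) : ZMod z)) ∈ (helixTurn z n).map Prod.fst := by
  fin_cases i <;> simp [helixTurn, right, up]

theorem rung_mem_helixTurn (i : Fin 4) (n : ℕ) :
    .inr (i + 1, ((n + i : ℕ) : ZMod z)) ∈ (helixTurn z n).map Prod.fst := by
  fin_cases i <;> simp [helixTurn, right, up]

/-- Per column these are half of the `4 * f + 4` heights of a period; the reflected helix supplies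
the other half. The irregular height `4 * f + 4` in column 3 is the last edge of `helixTwo`. -/
theorem mem_helix_arc {f n : ℕ} {i : Fin 4}
    (h : (i = 0 ∧ n % 2 = 0 ∧ n < 4 * f + 4) ∨ (i = 1 ∧ n % 2 = 1 ∧ n < 4 * f + 4) ∨
      (i = 2 ∧ n % 2 = 0 ∧ 2 ≤ n ∧ n ≤ 4 * f + 4) ∨
      (i = 3 ∧ (n % 2 = 1 ∧ 3 ≤ n ∧ n < 4 * f + 4 ∨ n = 4 * f + 4))) :
    .inl (i, (n : ZMod z)) ∈ (helix z f).map Prod.fst := by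
  rw [mem_helix_iff]
  have turn₁ : ∀ k < f + 1, n = 4 * k + i →
      ∃ k < f + 1, .inl (i, (n : ZMod z)) ∈ (helixTurn z (4 * k)).map Prod.fst := by
    rintro k hk rfl
    exact ⟨k, hk, arc_mem_helixTurn i _⟩
  have turn₂ : ∀ k < f, n = 4 * k + 2 + i →
      ∃ k < f, .inl (i, (n : ZMod z)) ∈ (helixTurn z (4 * k + 2)).map Prod.fst := by
    rintro k hk rfl
    exact ⟨k, hk, arc_mem_helixTurn i _⟩
  rcases h with ⟨rfl, h⟩ | ⟨rfl, h⟩ | ⟨rfl, h⟩ | ⟨rfl, h⟩ <;>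
    simp only [Fin.val_zero, Fin.val_one, Fin.val_two, val_three_fin_four] at turn₁ turn₂
  · by_cases h4 : n % 4 = 0
    · exact .inl (turn₁ (n / 4) (by omega) (by omega))
    · by_cases hk : n / 4 < f
      · exact .inr (.inr (.inl (turn₂ (n / 4) hk (by omega))))
      · obtain rfl : n = 4 * f + 2 := by omega
        exact .inr (.inr (.inr (by simp [right])))
  · by_cases h4 : n % 4 = 1
    · exact .inl (turn₁ (n / 4) (by omega) (by omega))
    · by_cases hk : n / 4 < f
      · exact .inr (.inr (.inl (turn₂ (n / 4) hk (by omega))))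
      · obtain rfl : n = 4 * f + 3 := by omega
        exact .inr (.inr (.inr (by simp [right])))
  · by_cases h4 : n % 4 = 2
    · exact .inl (turn₁ (n / 4) (by omega) (by omega))
    · by_cases hk : n / 4 - 1 < f
      · exact .inr (.inr (.inl (turn₂ (n / 4 - 1) hk (by omega))))
      · obtain rfl : n = 4 * f + 4 := by omega
        exact .inr (.inr (.inr (by simp [right])))
  · rcases h with h | rfl
    · by_cases h4 : n % 4 = 3
      · exact .inl (turn₁ (n / 4) (by omega) (by omega))
      · exact .inr (.inr (.inl (turn₂ (n / 4 - 1) (by omega) (by omega))))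
    · exact .inr (.inr (.inr (by simp [right])))

theorem mem_helix_rung {f n : ℕ} {i : Fin 4}
    (h : (i = 0 ∧ (n % 2 = 1 ∧ n < 4 * f + 4 ∨ n = 0)) ∨ (i = 1 ∧ n % 2 = 0 ∧ n < 4 * f + 4) ∨
      (i = 2 ∧ n % 2 = 1 ∧ n < 4 * f + 4) ∨ (i = 3 ∧ n % 2 = 0 ∧ 2 ≤ n ∧ n < 4 * f + 4)) :
    .inr (i, (n : ZMod z)) ∈ (helix z f).map Prod.fst := by
  rw [mem_helix_iff]
  have turn₁ : ∀ j : Fin 4, j + 1 = i → ∀ k < f + 1, n = 4 * k + j →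
      ∃ k < f + 1, .inr (i, (n : ZMod z)) ∈ (helixTurn z (4 * k)).map Prod.fst := by
    rintro j rfl k hk rfl
    exact ⟨k, hk, rung_mem_helixTurn j _⟩
  have turn₂ : ∀ j : Fin 4, j + 1 = i → ∀ k < f, n = 4 * k + 2 + j →
      ∃ k < f, .inr (i, (n : ZMod z)) ∈ (helixTurn z (4 * k + 2)).map Prod.fst := by
    rintro j rfl k hk rfl
    exact ⟨k, hk, rung_mem_helixTurn j _⟩
  rcases h with ⟨rfl, h⟩ | ⟨rfl, h⟩ | ⟨rfl, h⟩ | ⟨rfl, h⟩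
  · have turn₁ := turn₁ 3 rfl
    have turn₂ := turn₂ 3 rfl
    rw [val_three_fin_four] at turn₁ turn₂
    rcases h with h | rfl
    · by_cases h4 : n % 4 = 3
      · exact .inl (turn₁ (n / 4) (by omega) (by omega))
      · by_cases hk : n = 1
        · exact .inr (.inl (by simp [hk, up]))
        · exact .inr (.inr (.inl (turn₂ (n / 4 - 1) (by omega) (by omega))))
    · exact .inr (.inl (by simp [up]))
  · have turn₁ := turn₁ 0 rfl
    have turn₂ := turn₂ 0 rfl
    rw [Fin.val_zero] at turn₁ turn₂
    by_cases h4 : n % 4 = 0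
    · exact .inl (turn₁ (n / 4) (by omega) (by omega))
    · by_cases hk : n / 4 < f
      · exact .inr (.inr (.inl (turn₂ (n / 4) hk (by omega))))
      · obtain rfl : n = 4 * f + 2 := by omega
        exact .inr (.inr (.inr (by simp [up, right])))
  · have turn₁ := turn₁ 1 rfl
    have turn₂ := turn₂ 1 rfl
    rw [Fin.val_one] at turn₁ turn₂
    by_cases h4 : n % 4 = 1
    · exact .inl (turn₁ (n / 4) (by omega) (by omega))
    · by_cases hk : n / 4 < f
      · exact .inr (.inr (.inl (turn₂ (n / 4) hk (by omega))))
      · obtain rfl : n = 4 * f + 3 := by omega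
        exact .inr (.inr (.inr (by simp [up, right])))
  · have turn₁ := turn₁ 2 rfl
    have turn₂ := turn₂ 2 rfl
    rw [Fin.val_two] at turn₁ turn₂
    by_cases h4 : n % 4 = 2
    · exact .inl (turn₁ (n / 4) (by omega) (by omega))
    · exact .inr (.inr (.inl (turn₂ (n / 4 - 1) (by omega) (by omega))))

/-- This parity excludes consecutive edges in column 0. Column 2 is included because `flipDart`
carries it to column 0. -/
theorem exists_even_of_mem_helix {f : ℕ} {i : Fin 4} (hi : i = 0 ∨ i = 2) {h : ZMod z}
    (hm : .inl (i, h) ∈ (helix z f).map Prod.fst) : ∃ m : ℕ, h = ((2 * m : ℕ) : ZMod z) := by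
  rw [mem_helix_iff] at hm
  rcases hi with rfl | rfl
  · simp [helixTurn, right, up] at hm
    rcases hm with ⟨k, -, rfl⟩ | ⟨k, -, rfl⟩ | rfl
    · exact ⟨2 * k, by push_cast; ring⟩
    · exact ⟨2 * k + 1, by push_cast; ring⟩
    · exact ⟨2 * f + 1, by push_cast; ring⟩
  · simp [helixTurn, right, up] at hm
    rcases hm with ⟨k, -, rfl⟩ | ⟨k, -, rfl⟩ | rfl
    · exact ⟨2 * k + 1, by push_cast; ring⟩
    · exact ⟨2 * k + 2, by push_cast; ring⟩
    · exact ⟨2 * f + 2, by push_cast; ring⟩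

/-- Translation of the darts of `C_4 □ C_z`. -/
def shiftDart (k : ZMod z) :
    ((Fin 4 × ZMod z) ⊕ (Fin 4 × ZMod z)) × Bool → ((Fin 4 × ZMod z) ⊕ (Fin 4 × ZMod z)) × Bool
  | (.inl (i, h), b) => (.inl (i, k + h), b)
  | (.inr (i, h), b) => (.inr (i, k + h), b)

/-- The point reflection `(i, h) ↦ (3 - i, k - h)` on the darts of `C_4 □ C_z`. -/
def flipDart (k : ZMod z) :
    ((Fin 4 × ZMod z) ⊕ (Fin 4 × ZMod z)) × Bool → ((Fin 4 × ZMod z) ⊕ (Fin 4 × ZMod z)) × Bool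
  | (.inl (i, h), b) => (.inl (2 - i, k - h), !b)
  | (.inr (i, h), b) => (.inr (3 - i, k - (h + 1)), !b)

theorem colTail_shiftDart (k : ZMod z) (a : ((Fin 4 × ZMod z) ⊕ (Fin 4 × ZMod z)) × Bool) :
    colTail z (shiftDart k a) = ((colTail z a).1, k + (colTail z a).2) := by
  rcases a with ⟨⟨i, h⟩ | ⟨i, h⟩, _ | _⟩ <;> simp [shiftDart, add_assoc]

theorem colHead_shiftDart (k : ZMod z) (a : ((Fin 4 × ZMod z) ⊕ (Fin 4 × ZMod z)) × Bool) :
    colHead z (shiftDart k a) = ((colHead z a).1, k + (colHead z a).2) := by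
  rcases a with ⟨⟨i, h⟩ | ⟨i, h⟩, _ | _⟩ <;> simp [shiftDart, add_assoc]

theorem two_sub_add_one (i : Fin 4) : 2 - i + 1 = 3 - i := by
  revert i
  decide

theorem three_sub_sub_one (i : Fin 4) : 3 - i - 1 = 2 - i := by
  revert i
  decide

theorem colTail_flipDart (k : ZMod z) (a : ((Fin 4 × ZMod z) ⊕ (Fin 4 × ZMod z)) × Bool) :
    colTail z (flipDart k a) = (3 - (colTail z a).1, k - (colTail z a).2) := by
  rcases a with ⟨⟨i, h⟩ | ⟨i, h⟩, _ | _⟩ <;>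
    simp [flipDart, two_sub_add_one, three_sub_sub_one, sub_add_eq_sub_sub]

theorem colHead_flipDart (k : ZMod z) (a : ((Fin 4 × ZMod z) ⊕ (Fin 4 × ZMod z)) × Bool) :
    colHead z (flipDart k a) = (3 - (colHead z a).1, k - (colHead z a).2) := by
  rcases a with ⟨⟨i, h⟩ | ⟨i, h⟩, _ | _⟩ <;>
    simp [flipDart, two_sub_add_one, three_sub_sub_one, sub_add_eq_sub_sub]

theorem cylDim_shiftDart (k : ZMod z) (a : ((Fin 4 × ZMod z) ⊕ (Fin 4 × ZMod z)) × Bool) :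
    cylDim z (id : Fin 4 → Fin 4) (shiftDart k a).1 = cylDim z id a.1 := by
  rcases a with ⟨⟨i, h⟩ | ⟨i, h⟩, b⟩ <;> rfl

theorem cylDim_flipDart (k : ZMod z) (a : ((Fin 4 × ZMod z) ⊕ (Fin 4 × ZMod z)) × Bool) :
    cylDim z (id : Fin 4 → Fin 4) (flipDart k a).1 = (cylDim z id a.1).map (2 - ·) := by
  rcases a with ⟨⟨i, h⟩ | ⟨i, h⟩, b⟩ <;> rfl

theorem arc_mem_map_shiftDart {k h : ZMod z} {i : Fin 4}
    {l : List (((Fin 4 × ZMod z) ⊕ (Fin 4 × ZMod z)) × Bool)} :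
    .inl (i, h) ∈ (l.map (shiftDart k)).map Prod.fst ↔ .inl (i, h - k) ∈ l.map Prod.fst := by
  simp only [List.mem_map, exists_exists_and_eq_and]
  refine exists_congr fun a => and_congr_right fun _ => ?_
  rcases a with ⟨⟨i, h⟩ | ⟨i, h⟩, b⟩ <;> simp [shiftDart, eq_sub_iff_add_eq']

theorem rung_mem_map_shiftDart {k h : ZMod z} {i : Fin 4}
    {l : List (((Fin 4 × ZMod z) ⊕ (Fin 4 × ZMod z)) × Bool)} :
    .inr (i, h) ∈ (l.map (shiftDart k)).map Prod.fst ↔ .inr (i, h - k) ∈ l.map Prod.fst := by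
  simp only [List.mem_map, exists_exists_and_eq_and]
  refine exists_congr fun a => and_congr_right fun _ => ?_
  rcases a with ⟨⟨i, h⟩ | ⟨i, h⟩, b⟩ <;> simp [shiftDart, eq_sub_iff_add_eq']

theorem sub_eq_iff_eq_sub_comm {G : Type*} [AddCommGroup G] {a b c : G} :
    a - b = c ↔ b = a - c := by
  rw [sub_eq_iff_eq_add, eq_sub_iff_add_eq, eq_comm, add_comm]

theorem arc_mem_map_flipDart {k h : ZMod z} {i : Fin 4}
    {l : List (((Fin 4 × ZMod z) ⊕ (Fin 4 × ZMod z)) × Bool)} :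
    .inl (i, h) ∈ (l.map (flipDart k)).map Prod.fst ↔
      .inl (2 - i, k - h) ∈ l.map Prod.fst := by
  simp only [List.mem_map, exists_exists_and_eq_and]
  refine exists_congr fun a => and_congr_right fun _ => ?_
  rcases a with ⟨⟨i, h⟩ | ⟨i, h⟩, b⟩ <;> simp [flipDart, sub_eq_iff_eq_sub_comm]

theorem rung_mem_map_flipDart {k h : ZMod z} {i : Fin 4}
    {l : List (((Fin 4 × ZMod z) ⊕ (Fin 4 × ZMod z)) × Bool)} :
    .inr (i, h) ∈ (l.map (flipDart k)).map Prod.fst ↔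
      .inr (3 - i, k - h - 1) ∈ l.map Prod.fst := by
  simp only [List.mem_map, exists_exists_and_eq_and]
  refine exists_congr fun a => and_congr_right fun _ => ?_
  rcases a with ⟨⟨i, h⟩ | ⟨i, h⟩, b⟩ <;>
    simp [flipDart, sub_eq_iff_eq_sub_comm, eq_sub_iff_add_eq]

/-- The cycles are translates of a helix and of its point reflection. -/
theorem exists_columnDecomp_even {c : ℕ} (hc : 0 < c) (hc2 : Even c) (hz : 2 * c ∣ z)
    (hlt : 2 * c < z) :
    ∃ (J : Type) (_ : Fintype J) (l : J → List (((Fin 4 × ZMod z) ⊕ (Fin 4 × ZMod z)) × Bool)),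
      IsColumnDecomp z c l := by
  have : NeZero z := ⟨by omega⟩
  obtain ⟨f, rfl⟩ : ∃ f, c = 2 * (f + 1) := by
    obtain ⟨e, he⟩ := hc2
    exact ⟨e - 1, by omega⟩
  obtain ⟨q, hq⟩ := hz
  have hM : z = (4 * f + 4) * q := by rw [hq]; ring
  have h2 : 2 ∣ z := by rw [hM]; exact ⟨(2 * f + 2) * q, by ring⟩
  have hq0 : 0 < q := Nat.pos_of_ne_zero fun h => by simp [h] at hM; omega
  -- The period is `2 * c = 4 * f + 4`. Reflection with constant `4 * f + 5` makes the two halves of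
  -- a period complementary: horizontal edges go from height `m` to `4 * f + 5 - m`, rungs from `m`
  -- to `4 * f + 4 - m`.
  let l : Bool × Fin q → List (((Fin 4 × ZMod z) ⊕ (Fin 4 × ZMod z)) × Bool) := fun x =>
    bif x.1 then (helix z f).map (shiftDart (((4 * f + 4) * x.2 : ℕ) : ZMod z))
    else (helix z f).map (flipDart (((4 * f + 4) * x.2 + (4 * f + 4) + 1 : ℕ) : ZMod z))
  refine ⟨Bool × Fin q, inferInstance, l, IsColumnDecomp.of_surjective ?_ ?_ ?_ ?_ ?_ ?_ ?_⟩
  · simp only [Fintype.card_prod, Fintype.card_bool, Fintype.card_fin]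
    rw [hq]
    ring
  · rintro ⟨_ | _, k⟩
    · exact ⟨_, (isWalk_helix f).map (φ := fun x => (3 - x.1, _ - x.2)) (colTail_flipDart _)
        (colHead_flipDart _)⟩
    · exact ⟨_, (isWalk_helix f).map (φ := fun x => (x.1, _ + x.2)) (colTail_shiftDart _)
        (colHead_shiftDart _)⟩
  · have hn := nodup_tails_helix (z := z) (f := f) (by omega)
    rintro ⟨_ | _, k⟩
    · refine nodup_tails_map (φ := fun x => (3 - x.1, _ - x.2)) (fun x y hxy => ?_)
        (colTail_flipDart _) hn
      simpa [Prod.ext_iff] using hxy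
    · refine nodup_tails_map (φ := fun x => (x.1, _ + x.2)) (fun x y hxy => ?_)
        (colTail_shiftDart _) hn
      simpa [Prod.ext_iff] using hxy
  · rintro ⟨_ | _, k⟩ i
    · simp only [l, cond_false, List.map_map, Function.comp_def, cylDim_flipDart]
      have hinj : Function.Injective (Option.map fun i : Fin 4 => 2 - i) :=
        Option.map_injective sub_right_injective
      have := occ_map_of_injective hinj (some (2 - i))
        ((helix z f).map fun a => cylDim z (id : Fin 4 → Fin 4) a.1)
      rw [occ_some_helix] at this
      simpa [Function.comp_def] using this
    · simp only [l, cond_true, List.map_map, Function.comp_def, cylDim_shiftDart]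
      exact occ_some_helix f i
  · rintro ⟨_ | _, k⟩
    · simp only [l, cond_false, List.map_map, Function.comp_def, cylDim_flipDart]
      have hinj : Function.Injective (Option.map fun i : Fin 4 => 2 - i) :=
        Option.map_injective sub_right_injective
      have := occ_map_of_injective hinj none
        ((helix z f).map fun a => cylDim z (id : Fin 4 → Fin 4) a.1)
      rw [occ_none_helix] at this
      simpa [Function.comp_def] using this
    · simp only [l, cond_true, List.map_map, Function.comp_def, cylDim_shiftDart]
      exact occ_none_helix f
  · rintro ⟨_ | _, k⟩ h hm hm'
    · simp only [l, cond_false, arc_mem_map_flipDart] at hm hm'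
      obtain ⟨m, hm⟩ := exists_even_of_mem_helix (.inr rfl) hm
      obtain ⟨m', hm'⟩ := exists_even_of_mem_helix (.inr rfl) hm'
      rw [← sub_sub, hm, sub_eq_iff_eq_add] at hm'
      have := natCast_mod_two_eq (a := 2 * m) (b := 2 * m' + 1) h2 (by rw [hm']; push_cast; rfl)
      omega
    · simp only [l, cond_true, arc_mem_map_shiftDart] at hm hm'
      obtain ⟨m, hm⟩ := exists_even_of_mem_helix (.inl rfl) hm
      obtain ⟨m', hm'⟩ := exists_even_of_mem_helix (.inl rfl) hm'
      rw [add_sub_right_comm, hm] at hm'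
      have := natCast_mod_two_eq (a := 2 * m + 1) (b := 2 * m') h2 (by rw [← hm']; push_cast; rfl)
      omega
  -- The start `b` of the window of representatives is chosen for each column so that the heights
  -- used by the helix and by its reflection fill exactly this window.
  · have key : ∀ (y : ZMod z) (b : ℕ), ∃ (k : Fin q) (r : ℕ), b ≤ r ∧ r < 4 * f + 4 + b ∧
        y = (((4 * f + 4) * k + r : ℕ) : ZMod z) := by
      intro y b
      refine ⟨⟨(y - b).val / (4 * f + 4), ?_⟩, (y - b).val % (4 * f + 4) + b, by omega, ?_, ?_⟩
      · rw [Nat.div_lt_iff_lt_mul (by omega), mul_comm, ← hM]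
        exact (y - b).val_lt
      · have := Nat.mod_lt (y - b).val (y := 4 * f + 4) (by omega)
        omega
      · rw [← add_assoc, Nat.div_add_mod, Nat.cast_add, ZMod.natCast_zmod_val, sub_add_cancel]
    have arc₁ : ∀ (i : Fin 4) (k : Fin q) (r : ℕ),
        .inl (i, (r : ZMod z)) ∈ (helix z f).map Prod.fst →
        ∃ j, .inl (i, (((4 * f + 4) * k + r : ℕ) : ZMod z)) ∈ (l j).map Prod.fst := by
      intro i k r h
      refine ⟨(true, k), ?_⟩
      simp only [l, cond_true, arc_mem_map_shiftDart]
      rwa [Nat.cast_add, add_sub_cancel_left]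
    have rung₁ : ∀ (i : Fin 4) (k : Fin q) (r : ℕ),
        .inr (i, (r : ZMod z)) ∈ (helix z f).map Prod.fst →
        ∃ j, .inr (i, (((4 * f + 4) * k + r : ℕ) : ZMod z)) ∈ (l j).map Prod.fst := by
      intro i k r h
      refine ⟨(true, k), ?_⟩
      simp only [l, cond_true, rung_mem_map_shiftDart]
      rwa [Nat.cast_add, add_sub_cancel_left]
    have arc₂ : ∀ (i : Fin 4) (k : Fin q) (r m : ℕ), m + r = 4 * f + 5 →
        .inl (2 - i, (m : ZMod z)) ∈ (helix z f).map Prod.fst →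
        ∃ j, .inl (i, (((4 * f + 4) * k + r : ℕ) : ZMod z)) ∈ (l j).map Prod.fst := by
      intro i k r m hr h
      refine ⟨(false, k), ?_⟩
      simp only [l, cond_false, arc_mem_map_flipDart]
      rw [show (4 * f + 4) * (k : ℕ) + (4 * f + 4) + 1 = m + ((4 * f + 4) * k + r) by omega,
        Nat.cast_add m, add_sub_cancel_right]
      exact h
    have rung₂ : ∀ (i : Fin 4) (k : Fin q) (r m : ℕ), m + r = 4 * f + 4 →
        .inr (3 - i, (m : ZMod z)) ∈ (helix z f).map Prod.fst →
        ∃ j, .inr (i, (((4 * f + 4) * k + r : ℕ) : ZMod z)) ∈ (l j).map Prod.fst := by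
      intro i k r m hr h
      refine ⟨(false, k), ?_⟩
      simp only [l, cond_false, rung_mem_map_flipDart]
      rw [show (4 * f + 4) * (k : ℕ) + (4 * f + 4) + 1 = m + 1 + ((4 * f + 4) * k + r) by omega,
        Nat.cast_add (m + 1), add_sub_cancel_right, Nat.cast_succ, add_sub_cancel_right]
      exact h
    rintro (⟨i, y⟩ | ⟨i, y⟩)
    · have hi : i = 0 ∨ i = 1 ∨ i = 2 ∨ i = 3 := by revert i; decide
      rcases hi with rfl | rfl | rfl | rfl
      · obtain ⟨k, r, h1, h2, rfl⟩ := key y 0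
        rcases Nat.mod_two_eq_zero_or_one r with hr | hr
        · exact arc₁ _ k r (mem_helix_arc (.inl ⟨rfl, by omega⟩))
        · exact arc₂ _ k r (4 * f + 5 - r) (by omega)
            (mem_helix_arc (.inr (.inr (.inl ⟨rfl, by omega⟩))))
      · obtain ⟨k, r, h1, h2, rfl⟩ := key y 1
        rcases Nat.mod_two_eq_zero_or_one r with hr | hr
        · exact arc₂ _ k r (4 * f + 5 - r) (by omega)
            (mem_helix_arc (.inr (.inl ⟨rfl, by omega⟩)))
        · exact arc₁ _ k r (mem_helix_arc (.inr (.inl ⟨rfl, by omega⟩)))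
      · obtain ⟨k, r, h1, h2, rfl⟩ := key y 2
        rcases Nat.mod_two_eq_zero_or_one r with hr | hr
        · exact arc₁ _ k r (mem_helix_arc (.inr (.inr (.inl ⟨rfl, by omega⟩))))
        · exact arc₂ _ k r (4 * f + 5 - r) (by omega) (mem_helix_arc (.inl ⟨rfl, by omega⟩))
      · obtain ⟨k, r, h1, h2, rfl⟩ := key y 1
        by_cases hr : r % 2 = 1 ∧ 3 ≤ r ∨ r = 4 * f + 4
        · exact arc₁ _ k r (mem_helix_arc (.inr (.inr (.inr ⟨rfl, by omega⟩))))
        · exact arc₂ _ k r (4 * f + 5 - r) (by omega)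
            (mem_helix_arc (.inr (.inr (.inr ⟨rfl, by omega⟩))))
    · have hi : i = 0 ∨ i = 1 ∨ i = 2 ∨ i = 3 := by revert i; decide
      rcases hi with rfl | rfl | rfl | rfl
      · obtain ⟨k, r, h1, h2, rfl⟩ := key y 0
        by_cases hr : r % 2 = 1 ∨ r = 0
        · exact rung₁ _ k r (mem_helix_rung (.inl ⟨rfl, by omega⟩))
        · exact rung₂ _ k r (4 * f + 4 - r) (by omega)
            (mem_helix_rung (.inr (.inr (.inr ⟨rfl, by omega⟩))))
      · obtain ⟨k, r, h1, h2, rfl⟩ := key y 0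
        rcases Nat.mod_two_eq_zero_or_one r with hr | hr
        · exact rung₁ _ k r (mem_helix_rung (.inr (.inl ⟨rfl, by omega⟩)))
        · exact rung₂ _ k r (4 * f + 4 - r) (by omega)
            (mem_helix_rung (.inr (.inr (.inl ⟨rfl, by omega⟩))))
      · obtain ⟨k, r, h1, h2, rfl⟩ := key y 1
        rcases Nat.mod_two_eq_zero_or_one r with hr | hr
        · exact rung₂ _ k r (4 * f + 4 - r) (by omega)
            (mem_helix_rung (.inr (.inl ⟨rfl, by omega⟩)))
        · exact rung₁ _ k r (mem_helix_rung (.inr (.inr (.inl ⟨rfl, by omega⟩))))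
      · obtain ⟨k, r, h1, h2, rfl⟩ := key y 1
        by_cases hr : r % 2 = 0 ∧ r < 4 * f + 4
        · exact rung₁ _ k r (mem_helix_rung (.inr (.inr (.inr ⟨rfl, by omega⟩))))
        · exact rung₂ _ k r (4 * f + 4 - r) (by omega)
            (mem_helix_rung (.inl ⟨rfl, by omega⟩))

theorem exists_columnDecomp {c : ℕ} (hz : 1 < z) (hc : 2 * c ∣ z)
    (h : c = 1 ∨ Even c ∨ 2 * c = z) :
    ∃ (J : Type) (_ : Fintype J) (l : J → List (((Fin 4 × ZMod z) ⊕ (Fin 4 × ZMod z)) × Bool)),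
      IsColumnDecomp z c l := by
  have hc0 : 0 < c := Nat.pos_of_ne_zero fun h0 => by simp [h0] at hc; omega
  by_cases hlt : 2 * c = z
  · exact exists_columnDecomp_half hc0 hlt
  · rcases h with rfl | h | h
    · exact exists_columnDecomp_one hz
    · exact exists_columnDecomp_even hc0 h hc
        (lt_of_le_of_ne (Nat.le_of_dvd (by omega) hc) hlt)
    · exact absurd h hlt

end Helix
-- Induction over the factors of the torus.
section Torus

theorem HasBalancedDecomp.map {V E ι V' E' ι' : Type*} [DecidableEq E] [DecidableEq ι]
    [DecidableEq E'] [DecidableEq ι'] {s t : E → V} {dim : E → ι} {s' t' : E' → V'}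
    {dim' : E' → ι'} {R : ℕ} (h : HasBalancedDecomp s t dim R) {φ : V → V'} {ψ : E → E'}
    {σ : ι → ι'} (hφ : φ.Injective) (hψ : ψ.Bijective) (hσ : σ.Bijective)
    (hs : ∀ e, s' (ψ e) = φ (s e)) (ht : ∀ e, t' (ψ e) = φ (t e))
    (hdim : ∀ e, dim' (ψ e) = σ (dim e)) : HasBalancedDecomp s' t' dim' R := by
  obtain ⟨J, _, l, hl, hc⟩ := h
  have hs' : ∀ a : E × Bool, dartTail s' t' (ψ a.1, a.2) = φ (dartTail s t a) := by
    rintro ⟨e, _ | _⟩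
    exacts [ht e, hs e]
  have ht' : ∀ a : E × Bool, dartTail t' s' (ψ a.1, a.2) = φ (dartTail t s a) := by
    rintro ⟨e, _ | _⟩
    exacts [hs e, ht e]
  refine ⟨J, inferInstance, fun j => (l j).map fun a => (ψ a.1, a.2), ⟨fun j => ?_, fun j => ?_,
    fun e' => ?_⟩, fun j i' => ?_⟩
  · obtain ⟨u, hu⟩ := hl.closed j
    exact ⟨_, hu.map hs' ht'⟩
  · exact nodup_tails_map hφ hs' (hl.nodup j)
  · obtain ⟨e, rfl⟩ := hψ.2 e'
    rw [← hl.cover e]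
    refine Finset.sum_congr rfl fun j _ => ?_
    rw [← occ_map_of_injective hψ.1]
    simp [Function.comp_def]
  · obtain ⟨i, rfl⟩ := hσ.2 i'
    rw [← hc j i, ← occ_map_of_injective hσ.1]
    simp [Function.comp_def, hdim]

variable {κ : Type*} [DecidableEq κ]

/-- The end of an edge of the torus. -/
def torusTgt (n : κ → ℕ) (e : (∀ i, ZMod (n i)) × κ) : ∀ i, ZMod (n i) :=
  Function.update e.1 e.2 (e.1 e.2 + 1)

theorem card_filter_torusSrc [Fintype κ] (n : κ → ℕ) [∀ i, NeZero (n i)]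
    (v : ∀ i, ZMod (n i)) :
    (Finset.univ.filter fun e : (∀ i, ZMod (n i)) × κ => e.1 = v).card = Fintype.card κ := by
  rw [← Finset.card_univ]
  refine (Finset.card_bij (fun i _ => (v, i))
    (fun i _ => Finset.mem_filter.2 ⟨Finset.mem_univ _, rfl⟩) (by simp) ?_).symm
  rintro ⟨w, i⟩ hw
  obtain rfl : w = v := (Finset.mem_filter.1 hw).2
  exact ⟨i, Finset.mem_univ _, rfl⟩

theorem card_filter_torusTgt [Fintype κ] (n : κ → ℕ) [∀ i, NeZero (n i)]
    (v : ∀ i, ZMod (n i)) :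
    (Finset.univ.filter fun e : (∀ i, ZMod (n i)) × κ => torusTgt n e = v).card =
      Fintype.card κ := by
  rw [← Finset.card_univ]
  refine (Finset.card_bij (fun i _ => (Function.update v i (v i - 1), i))
    (fun i _ => Finset.mem_filter.2 ⟨Finset.mem_univ _, by simp [torusTgt]⟩)
    (fun i _ j _ h => (Prod.ext_iff.1 h).2) ?_).symm
  rintro ⟨w, i⟩ hw
  obtain rfl : torusTgt n (w, i) = v := (Finset.mem_filter.1 hw).2
  refine ⟨i, Finset.mem_univ _, ?_⟩
  simp [torusTgt]

theorem HasBalancedDecomp.torus_reindex {κ' : Type*} [DecidableEq κ'] [Fintype κ] [Fintype κ']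
    (e : κ ≃ κ') (n : κ' → ℕ) {R : ℕ}
    (h : HasBalancedDecomp Prod.fst (torusTgt fun i => n (e i)) Prod.snd R) :
    HasBalancedDecomp Prod.fst (torusTgt n) Prod.snd R := by
  have key : ∀ (x : ∀ i, ZMod (n (e i))) i,
      Equiv.piCongrLeft (fun i => ZMod (n i)) e x (e i) = x i :=
    fun x i => Equiv.piCongrLeft_apply_apply (fun i => ZMod (n i)) e x i
  refine h.map (φ := Equiv.piCongrLeft (fun i => ZMod (n i)) e)
    (ψ := Equiv.prodCongr (Equiv.piCongrLeft (fun i => ZMod (n i)) e) e) (σ := e)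
    (Equiv.injective _) (Equiv.bijective _) e.bijective (fun _ => rfl) ?_ (fun _ => rfl)
  rintro ⟨x, i⟩
  funext j
  obtain ⟨j, rfl⟩ := e.surjective j
  rw [key]
  change Function.update (β := fun i => ZMod (n i))
    (Equiv.piCongrLeft (fun i => ZMod (n i)) e x) (e i) (Equiv.piCongrLeft (fun i => ZMod (n i)) e x (e i) + 1) (e j) =
    Function.update x i (x i + 1) j
  by_cases hij : j = i
  · subst hij
    rw [Function.update_self, Function.update_self, key]
  · rw [Function.update_of_ne hij, Function.update_of_ne fun h => hij (e.injective h)]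
    exact key x j

/-- The torus indexed by `Option κ` is the cylinder over the torus indexed by `κ`, with `none` as
the vertical dimension. -/
theorem HasBalancedDecomp.torus_option [Fintype κ] [Nonempty κ] (n : Option κ → ℕ)
    [∀ i, NeZero (n i)] {R c : ℕ}
    (h : HasBalancedDecomp Prod.fst (torusTgt fun i => n (some i)) Prod.snd R) (h4 : 4 ∣ R)
    (hR : 0 < R) (hz : 1 < n none) (hc : 2 * c ∣ n none)
    (hc' : c = 1 ∨ Even c ∨ 2 * c = n none) :
    HasBalancedDecomp Prod.fst (torusTgt n) Prod.snd (c * R) := by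
  obtain ⟨J₀, _, l₀, h₀⟩ := exists_columnDecomp hz hc hc'
  have h' := h.cyl hz h4 hR (card_filter_torusSrc _) (card_filter_torusTgt _) h₀
  let φ : (∀ i, ZMod (n (some i))) × ZMod (n none) → ∀ i, ZMod (n i) :=
    fun x o => match o with
      | none => x.2
      | some i => x.1 i
  have hφ : φ.Injective := by
    rintro ⟨x, a⟩ ⟨y, b⟩ hxy
    exact Prod.ext (funext fun i => congrFun hxy (some i)) (congrFun hxy none)
  let ψ : (((∀ i, ZMod (n (some i))) × κ) × ZMod (n none)) ⊕
      ((∀ i, ZMod (n (some i))) × ZMod (n none)) → (∀ i, ZMod (n i)) × Option κ :=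
    Sum.elim (fun x => (φ (x.1.1, x.2), some x.1.2)) (fun x => (φ x, none))
  have hψ : ψ.Bijective := by
    constructor
    · rintro (⟨⟨x, i⟩, a⟩ | ⟨x, a⟩) (⟨⟨y, j⟩, b⟩ | ⟨y, b⟩) hxy <;>
        simp_all [ψ, hφ.eq_iff]
    · have hsurj : ∀ w, ∃ x, φ x = w := fun w =>
        ⟨(fun i => w (some i), w none), by funext o; cases o <;> rfl⟩
      rintro ⟨w, _ | i⟩
      · obtain ⟨x, rfl⟩ := hsurj w
        exact ⟨.inr x, rfl⟩
      · obtain ⟨x, rfl⟩ := hsurj w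
        exact ⟨.inl ((x.1, i), x.2), rfl⟩
  refine h'.map (σ := id) hφ hψ Function.bijective_id ?_ ?_ ?_
  · rintro (⟨⟨x, i⟩, a⟩ | ⟨x, a⟩) <;> rfl
  · rintro (⟨⟨x, i⟩, a⟩ | ⟨x, a⟩)
    · funext o
      cases o with
      | none => simp [torusTgt, ψ, φ]
      | some j =>
        by_cases hij : j = i
        · subst hij
          simp [torusTgt, ψ, φ]
          rfl
        · simp [torusTgt, ψ, φ, Function.update_of_ne, hij]
    · funext o
      cases o with
      | none =>
        simp [torusTgt, ψ, φ]
        rfl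
      | some j => simp [torusTgt, ψ, φ]
  · rintro (⟨⟨x, i⟩, a⟩ | ⟨x, a⟩) <;> rfl

theorem hasBalancedDecomp_torus_fin_one (n : Fin 1 → ℕ) (hn : 0 < n 0) :
    HasBalancedDecomp Prod.fst (torusTgt n) Prod.snd (n 0) := by
  have : NeZero (n 0) := ⟨hn.ne'⟩
  let v : ℕ → ∀ i, ZMod (n i) := fun k _ => (k : ZMod _)
  have hv : ∀ k < n 0, ∀ k' < n 0, v k = v k' → k = k' := fun k hk k' hk' h =>
    natCast_inj_of_lt hk hk' (congrFun h 0)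
  refine ⟨Unit, inferInstance, fun _ => (List.range (n 0)).flatMap fun k => [((v k, 0), true)],
    ⟨fun _ => ⟨v 0, ?_⟩, fun _ => ?_, fun e => ?_⟩, fun _ i => ?_⟩
  · have := isWalk_flatMap_range (s := Prod.fst) (t := torusTgt n) v
      (fun k => [((v k, 0), true)]) (n 0) ?_
    · have e : v (n 0) = v 0 := by
        funext i
        obtain rfl := Subsingleton.elim i 0
        simp [v]
      rwa [e] at this
    · intro k _
      refine ⟨rfl, ?_⟩
      funext i
      obtain rfl := Subsingleton.elim i 0
      simp [torusTgt, v]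
  · rw [List.map_flatMap, List.nodup_flatMap]
    refine ⟨fun k _ => List.nodup_singleton _, ?_⟩
    refine List.Pairwise.imp_of_mem ?_ List.nodup_range
    intro k k' hk hk' hne x hx hx'
    rw [List.mem_range] at hk hk'
    obtain rfl := List.mem_singleton.1 hx
    exact hne (hv k hk k' hk' (List.mem_singleton.1 hx'))
  · obtain ⟨w, i⟩ := e
    obtain rfl := Subsingleton.elim i 0
    have hw : w = v (w 0).val := by
      funext i
      obtain rfl := Subsingleton.elim i 0
      exact (ZMod.natCast_zmod_val _).symm
    rw [Fintype.sum_unique, List.map_flatMap, occ_flatMap, hw]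
    have h1 := (w 0).val_lt
    generalize (w 0).val = k at h1
    rw [List.sum_map_eq_nsmul_single k]
    · simp [occ_cons, h1]
    · intro k' hne hk'
      rw [List.mem_range] at hk'
      have : v k' ≠ v k := fun h => hne (hv k' hk' k h1 h)
      simp [occ_cons, this]
  · obtain rfl := Subsingleton.elim i 0
    simp [List.map_flatMap, occ_flatMap, occ_cons]

/-- The last factor is split off, so factor 0 remains the base cycle. Divisibility by 4 persists
because `R` is only ever multiplied. -/
theorem hasBalancedDecomp_torus {m : ℕ} (n : Fin (m + 1) → ℕ) (c : Fin m → ℕ) (h4 : 4 ∣ n 0)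
    (hn : 0 < n 0) (hn' : ∀ k : Fin m, 1 < n k.succ) (hc : ∀ k, 2 * c k ∣ n k.succ)
    (hc' : ∀ k, c k = 1 ∨ Even (c k) ∨ 2 * c k = n k.succ) :
    HasBalancedDecomp Prod.fst (torusTgt n) Prod.snd (n 0 * ∏ k, c k) := by
  induction m with
  | zero => simpa using hasBalancedDecomp_torus_fin_one n hn
  | succ m ih =>
    have hcpos : ∀ k, 0 < c k := fun k => Nat.pos_of_ne_zero fun h => by
      have h1 := hc k
      have h2 := hn' k
      simp only [h, mul_zero, zero_dvd_iff] at h1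
      omega
    have : ∀ i, NeZero (n i) := fun i => ⟨by
      refine Fin.cases hn.ne' (fun k => ?_) i
      have := hn' k
      omega⟩
    have e1 : ∀ i : Fin (m + 1), finSuccEquivLast.symm (some i) = i.castSucc := fun i => by simp
    have e2 : finSuccEquivLast.symm none = Fin.last (m + 1) := by simp
    have ih' := ih (fun i => n (finSuccEquivLast.symm (some i))) (fun k => c k.castSucc)
      (by rw [e1]; exact h4) (by rw [e1]; exact hn) (fun k => by rw [e1]; exact hn' k.castSucc)
      (fun k => by rw [e1]; exact hc k.castSucc) (fun k => by rw [e1]; exact hc' k.castSucc)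
    rw [e1, Fin.castSucc_zero] at ih'
    refine HasBalancedDecomp.torus_reindex finSuccEquivLast.symm n ?_
    have := HasBalancedDecomp.torus_option (fun o => n (finSuccEquivLast.symm o))
      (R := n 0 * ∏ k : Fin m, c k.castSucc) (c := c (Fin.last m)) ?_ (h4.mul_right _)
      (Nat.mul_pos hn (Finset.prod_pos fun k _ => hcpos _)) ?_ ?_ ?_
    · rw [Fin.prod_univ_castSucc, ← mul_assoc, mul_comm _ (c (Fin.last m))]
      exact this
    · exact ih'
    · rw [e2]
      exact hn' (Fin.last m)
    · rw [e2]
      exact hc (Fin.last m)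
    · rw [e2]
      exact hc' (Fin.last m)

end Torus
-- From families of closed walks to subgraphs of the torus.
section Subgraphs

/-- The subgraph that consists of the edges in `F` and their ends. -/
def edgeSubgraph {α β : Type*} (G : Graph α β) (F : Set β) : Graph α β where
  vertexSet := {x | ∃ e ∈ F, ∃ y, G.IsLink e x y}
  IsLink e x y := e ∈ F ∧ G.IsLink e x y
  isLink_symm := fun _ _ => ⟨fun _ _ h => ⟨h.1, h.2.symm⟩⟩
  eq_or_eq_of_isLink_of_isLink := fun _ _ _ _ _ h h' =>
    G.eq_or_eq_of_isLink_of_isLink h.2 h'.2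
  left_mem_of_isLink := fun e _ y h => ⟨e, h.1, y, h.2⟩

theorem edgeSubgraph_le {α β : Type*} (G : Graph α β) (F : Set β) : edgeSubgraph G F ≤ G :=
  ⟨fun _ ⟨_, _, _, h⟩ => h.left_mem, fun _ _ _ h => h.2⟩

variable {d : ℕ} {n : Fin d → ℕ}

theorem torus_isLink_dart (a : ((∀ i, ZMod (n i)) × Fin d) × Bool) :
    (torus n).IsLink a.1 (dartTail Prod.fst (torusTgt n) a) (dartTail (torusTgt n) Prod.fst a) := by
  rcases a with ⟨e, _ | _⟩
  · exact .inr ⟨rfl, rfl⟩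
  · exact .inl ⟨rfl, rfl⟩

theorem edgeSet_edgeSubgraph_torus (F : Set ((∀ i, ZMod (n i)) × Fin d)) :
    (edgeSubgraph (torus n) F).edgeSet = F := by
  ext e
  exact ⟨fun ⟨_, _, h⟩ => h.1, fun h => ⟨_, _, h, torus_isLink_dart (e, true)⟩⟩

theorem IsWalk.head_getElem {V E : Type*} {s t : E → V} {u : V} {l : List (E × Bool)}
    (h : IsWalk s t u l u) (i : ℕ) (hi : i < l.length) :
    dartTail t s l[i] = dartTail s t (l[(i + 1) % l.length]'(Nat.mod_lt _ (by omega))) := by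
  have h1 := h.tails_append
  have h2 : (l.map (dartTail s t) ++ [u])[i + 1]? = (u :: l.map (dartTail t s))[i + 1]? := by
    rw [h1]
  have h3 : (l.map (dartTail s t) ++ [u])[0]? = (u :: l.map (dartTail t s))[0]? := by rw [h1]
  rw [List.getElem?_cons_succ] at h2
  rw [List.getElem?_cons_zero] at h3
  by_cases hlt : i + 1 < l.length
  · rw [List.getElem?_append_left (by simpa using hlt)] at h2
    simp only [Nat.mod_eq_of_lt hlt]
    simpa [hi, hlt] using h2.symm
  · obtain hlen : i + 1 = l.length := by omega
    rw [List.getElem?_append_left (by simp; omega)] at h3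
    simp only [hlen, Nat.mod_self]
    have h4 : 0 < l.length := by omega
    simp [hlen, hi, h4] at h2 h3
    rw [← h2, h3]

theorem isCycleOfLength_edgeSubgraph {l : List (((∀ i, ZMod (n i)) × Fin d) × Bool)}
    {u : ∀ i, ZMod (n i)} (hw : IsWalk Prod.fst (torusTgt n) u l u)
    (hn : (l.map (dartTail Prod.fst (torusTgt n))).Nodup) (he : (l.map Prod.fst).Nodup)
    (hl : 2 ≤ l.length) :
    IsCycleOfLength (edgeSubgraph (torus n) {e | e ∈ l.map Prod.fst}) l.length := by
  have : NeZero l.length := ⟨by omega⟩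
  have : Fact (1 < l.length) := ⟨hl⟩
  have hlink : ∀ k : ZMod l.length, (torus n).IsLink (l[k.val]'k.val_lt).1
      (dartTail Prod.fst (torusTgt n) (l[k.val]'k.val_lt))
      (dartTail Prod.fst (torusTgt n) (l[(k + 1).val]'(k + 1).val_lt)) := by
    intro k
    have h1 := torus_isLink_dart (l[k.val]'k.val_lt)
    rw [hw.head_getElem k.val k.val_lt] at h1
    simpa only [ZMod.val_add, ZMod.val_one] using h1
  have hmem : ∀ k : ZMod l.length, (l[k.val]'k.val_lt).1 ∈ l.map Prod.fst := fun k =>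
    List.mem_map_of_mem (List.getElem_mem _)
  have hget : ∀ a ∈ l, ∃ k : ZMod l.length, l[k.val]'k.val_lt = a := by
    intro a ha
    obtain ⟨i, hi, rfl⟩ := List.getElem_of_mem ha
    refine ⟨(i : ZMod l.length), ?_⟩
    simp only [ZMod.val_cast_of_lt hi]
  refine ⟨hl, fun k => dartTail Prod.fst (torusTgt n) (l[k.val]'k.val_lt),
    fun k => (l[k.val]'k.val_lt).1, ?_, ?_, ?_, ?_, fun k => ⟨hmem k, hlink k⟩⟩
  · intro k k' hk
    refine ZMod.val_injective _ ((List.Nodup.getElem_inj_iff hn (hi := by simpa using k.val_lt)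
      (hj := by simpa using k'.val_lt)).1 ?_)
    simpa using hk
  · intro k k' hk
    refine ZMod.val_injective _ ((List.Nodup.getElem_inj_iff he (hi := by simpa using k.val_lt)
      (hj := by simpa using k'.val_lt)).1 ?_)
    simpa using hk
  · ext x
    constructor
    · rintro ⟨e, he, y, hxy⟩
      obtain ⟨a, ha, rfl⟩ := List.mem_map.1 he
      obtain ⟨k, rfl⟩ := hget a ha
      rcases (torus n).eq_or_eq_of_isLink_of_isLink hxy (hlink k) with rfl | rfl
      exacts [⟨k, rfl⟩, ⟨k + 1, rfl⟩]
    · rintro ⟨k, rfl⟩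
      exact ⟨_, hmem k, _, hlink k⟩
  · rw [edgeSet_edgeSubgraph_torus]
    ext e
    constructor
    · intro he
      obtain ⟨a, ha, rfl⟩ := List.mem_map.1 he
      obtain ⟨k, rfl⟩ := hget a ha
      exact ⟨k, rfl⟩
    · rintro ⟨k, rfl⟩
      exact hmem k

theorem HasBalancedDecomp.exists_isDecomposition [∀ i, NeZero (n i)] {R K : ℕ}
    (h : HasBalancedDecomp Prod.fst (torusTgt n) Prod.snd R) (hd : 0 < d) (hR : 2 ≤ R)
    (hK : K * R = ∏ i, n i) :
    ∃ H : Fin K → Graph (∀ i, ZMod (n i)) ((∀ i, ZMod (n i)) × Fin d),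
      IsDecomposition (torus n) H ∧
      ∀ j, IsCycleOfLength (H j) (d * R) ∧ ∀ i, {e ∈ (H j).edgeSet | e.2 = i}.ncard = R := by
  obtain ⟨J, _, l, hl, hc⟩ := h
  have hlen : ∀ j, (l j).length = d * R := fun j => by
    simpa using length_eq_of_count (hc j)
  -- The torus has `d * ∏ i, n i = d * (K * R)` edges and each cycle has `d * R`.
  have hcard : Fintype.card J = K := by
    have h1 := hl.sum_sum_map fun _ => 1
    simp only [List.map_const', List.sum_replicate, hlen, Finset.sum_const, Finset.card_univ,
      smul_eq_mul, mul_one, Fintype.card_prod, Fintype.card_pi, ZMod.card, Fintype.card_fin,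
      ← hK] at h1
    refine Nat.eq_of_mul_eq_mul_right (Nat.mul_pos hd (by omega : 0 < R)) ?_
    rw [h1]
    ring
  have hcov : ∀ e, ∃ j, e ∈ (l j).map Prod.fst := by
    intro e
    by_contra! hne
    have h1 := hl.cover e
    simp only [fun j => occ_eq_zero.2 (hne j), Finset.sum_const_zero] at h1
    exact absurd h1 (by decide)
  let ε : Fin K ≃ J := (finCongr hcard.symm).trans (Fintype.equivFin J).symm
  refine ⟨fun j => edgeSubgraph (torus n) {e | e ∈ (l (ε j)).map Prod.fst},
    ⟨fun j => edgeSubgraph_le _ _, ?_, ?_, ?_⟩, fun j => ⟨?_, fun i => ?_⟩⟩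
  · refine Set.Subset.antisymm (fun x _ => ?_) fun _ _ => Set.mem_univ _
    obtain ⟨j, hj⟩ := hcov (x, ⟨0, hd⟩)
    refine Set.mem_iUnion.2 ⟨ε.symm j, (x, ⟨0, hd⟩), ?_, _, torus_isLink_dart (_, true)⟩
    rwa [ε.apply_symm_apply]
  · refine Set.Subset.antisymm (fun e _ => ?_) fun _ _ => Set.mem_univ _
    obtain ⟨j, hj⟩ := hcov e
    refine Set.mem_iUnion.2 ⟨ε.symm j, ?_⟩
    rw [edgeSet_edgeSubgraph_torus, ε.apply_symm_apply]
    exact hj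
  · intro j j' hne
    simp only [edgeSet_edgeSubgraph_torus]
    refine Set.disjoint_left.2 fun e he he' => ?_
    have h1 := hl.cover e
    have h2 := Finset.add_le_sum (s := Finset.univ) (f := fun j => occ e ((l j).map Prod.fst))
      (fun _ _ => Nat.zero_le _) (Finset.mem_univ (ε j)) (Finset.mem_univ (ε j'))
      fun h => hne (ε.injective h)
    have h3 := occ_pos.2 he
    have h4 := occ_pos.2 he'
    omega
  · obtain ⟨u, hu⟩ := hl.closed (ε j)
    rw [← hlen (ε j)]
    refine isCycleOfLength_edgeSubgraph hu (hl.nodup _) (hl.nodup_edges _) ?_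
    rw [hlen]
    nlinarith
  · rw [edgeSet_edgeSubgraph_torus, ← hc (ε j) i]
    have h1 : {e | e ∈ {e | e ∈ (l (ε j)).map Prod.fst} ∧ e.2 = i} =
        ((((l (ε j)).map Prod.fst).filter fun e => e.2 = i).toFinset : Set _) := by
      ext e
      simp
    rw [h1, Set.ncard_coe_finset, List.toFinset_card_of_nodup ((hl.nodup_edges _).filter _),
      ← List.countP_eq_length_filter, List.countP_map]
    simp only [occ, List.count, List.countP_map]
    exact List.countP_congr (by simp)

end Subgraphs

/-! ### The possible values of the `A_k`, and the theorem. -/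

theorem eta_eq_zero_or_one (y c : ℕ) : eta y c = 0 ∨ eta y c = 1 := by
  unfold eta
  split_ifs <;> simp

theorem A_three_eq (z b : ℕ → ℕ) (d : ℕ) : A z b d 3 = z 1 ∨ A z b d 3 = 2 * (b 1 + 1) := by
  rcases eta_eq_zero_or_one (z d * (b 1 + 1) + 1) (alphaMax z d 2) with h | h
  · right
    simp [A, A₂, h]
  · left
    simp [A, A₂, h]

/-- Both exponents are 0 or 1, and the factor `1 - η` in the first prevents them from being 1
together. -/
theorem A_add_four_eq (z b : ℕ → ℕ) (d k : ℕ) :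
    A z b d (k + 4) = 1 ∨ A z b d (k + 4) = b (k + 2) + 1 ∨
      A z b d (k + 4) = z (k + 2) / 2 := by
  have h1 : etaAlpha z b d (k + 2) = 0 ∨ etaAlpha z b d (k + 2) = 1 := eta_eq_zero_or_one _ _
  have h2 : etaAlpha z b d (k + 3) = 0 ∨ etaAlpha z b d (k + 3) = 1 := eta_eq_zero_or_one _ _
  rcases h1 with h1 | h1 <;> rcases h2 with h2 | h2 <;> simp [A, h1, h2]

end LockKey

theorem theorem5 (d : ℕ) (hd : 2 ≤ d) (z b : ℕ → ℕ)
    (hz : ∀ i, 1 ≤ i → i ≤ d → 0 < z i ∧ Even (z i))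
    (hb : ∀ i, 1 ≤ i → i ≤ d - 1 → Odd (b i) ∨ b i = 0)
    (h4 : 4 ∣ z d)
    (hA3 : LockKey.A z b d 3 ∣ z 1)
    (hA : ∀ k, 3 ≤ k → k ≤ d → 2 * LockKey.A z b d (k + 1) ∣ z (k - 1)) :
    ∃ H : Fin (2 * ∏ k ∈ Finset.range (d - 1), z (k + 1) / LockKey.A z b d (k + 3)) →
        Graph (∀ i, ZMod (LockKey.factorLength z d i))
          ((∀ i, ZMod (LockKey.factorLength z d i)) × Fin d),
      LockKey.IsDecomposition (LockKey.torus (LockKey.factorLength z d)) H ∧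
      ∀ j,
        LockKey.IsCycleOfLength (H j)
          (d * z d / 2 * ∏ k ∈ Finset.range (d - 1), LockKey.A z b d (k + 3)) ∧
        ∀ i : Fin d, {e ∈ (H j).edgeSet | e.2 = i}.ncard =
          z d / 2 * ∏ k ∈ Finset.range (d - 1), LockKey.A z b d (k + 3) := by
  obtain ⟨m, rfl⟩ : ∃ m, d = m + 2 := ⟨d - 2, by omega⟩
  -- The multiplier for the factor `z 1` is half of `A_3`; those for the later factors are the `A_k`
  -- themselves.
  have hA0 : ∃ c₀, LockKey.A z b (m + 2) 3 = 2 * c₀ ∧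
      (c₀ = 1 ∨ Even c₀ ∨ 2 * c₀ = z 1) := by
    rcases LockKey.A_three_eq z b (m + 2) with h | h
    · obtain ⟨q, hq⟩ := (hz 1 le_rfl (by omega)).2
      exact ⟨q, by omega, by omega⟩
    · refine ⟨b 1 + 1, h, ?_⟩
      rcases hb 1 le_rfl (by omega) with h1 | h1
      · exact .inr (.inl h1.add_one)
      · exact .inl (by omega)
  obtain ⟨c₀, hc₀, hc₀'⟩ := hA0
  have hA' : ∀ k < m, LockKey.A z b (m + 2) (k + 4) = 1 ∨
      Even (LockKey.A z b (m + 2) (k + 4)) ∨ 2 * LockKey.A z b (m + 2) (k + 4) = z (k + 2) := by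
    intro k hk
    rcases LockKey.A_add_four_eq z b (m + 2) k with h | h | h
    · exact .inl h
    · rw [h]
      rcases hb (k + 2) (by omega) (by omega) with h1 | h1
      · exact .inr (.inl h1.add_one)
      · exact .inl (by omega)
    · obtain ⟨q, hq⟩ := (hz (k + 2) (by omega) (by omega)).2
      exact .inr (.inr (by omega))
  have hAd : ∀ k < m, 2 * LockKey.A z b (m + 2) (k + 4) ∣ z (k + 2) := fun k hk =>
    hA (k + 3) (by omega) (by omega)
  -- The induction starts from index 0, which must carry the length divisible by 4; the swap moves
  -- `z_d` there.
  have hf0 : LockKey.factorLength z (m + 2) (Equiv.swap 0 1 0) = z (m + 2) := by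
    simp [LockKey.factorLength]
  have hf1 : LockKey.factorLength z (m + 2) (Equiv.swap 0 1 (Fin.succ 0)) = z 1 := by
    simp [LockKey.factorLength]
  have hf2 : ∀ k : Fin m, LockKey.factorLength z (m + 2) (Equiv.swap 0 1 k.succ.succ) =
      z (k + 2) := by
    intro k
    rw [Equiv.swap_apply_of_ne_of_ne (Fin.succ_ne_zero _)
      (by rw [← Fin.succ_zero_eq_one]; exact fun h => Fin.succ_ne_zero _ (Fin.succ_injective _ h))]
    simp [LockKey.factorLength]
  have hz1 : ∀ i, 1 ≤ i → i ≤ m + 2 → 1 < z i := by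
    intro i h1 h2
    obtain ⟨h3, q, hq⟩ := hz i h1 h2
    omega
  have hdec := LockKey.HasBalancedDecomp.torus_reindex (Equiv.swap 0 1)
    (LockKey.factorLength z (m + 2)) (LockKey.hasBalancedDecomp_torus _
      (Fin.cons c₀ fun k : Fin m => LockKey.A z b (m + 2) (k + 4)) (by rwa [hf0])
      (by rw [hf0]; exact (hz _ (by omega) le_rfl).1) ?_ ?_ ?_)
  rotate_left
  · refine Fin.cases ?_ fun k => ?_
    · rw [hf1]
      exact hz1 1 le_rfl (by omega)
    · rw [hf2]
      exact hz1 _ (by omega) (by omega)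
  · refine Fin.cases ?_ fun k => ?_
    · rw [hf1, Fin.cons_zero, ← hc₀]
      exact hA3
    · rw [hf2, Fin.cons_succ]
      exact hAd k k.2
  · refine Fin.cases ?_ fun k => ?_
    · rw [hf1, Fin.cons_zero]
      exact hc₀'
    · rw [hf2, Fin.cons_succ]
      exact hA' k k.2
  have : ∀ i, NeZero (LockKey.factorLength z (m + 2) i) := by
    intro i
    refine ⟨?_⟩
    unfold LockKey.factorLength
    have := i.2
    split_ifs
    · exact (hz1 _ le_rfl (by omega)).ne_bot
    · exact (hz1 _ (by omega) le_rfl).ne_bot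
    · exact (hz1 _ (by omega) (by omega)).ne_bot
  -- The factor 2 in `A_3 = 2 * c₀` is what turns `z_d` into `z_d / 2`.
  have hR : LockKey.factorLength z (m + 2) (Equiv.swap 0 1 0) *
      ∏ k, (Fin.cons c₀ fun k : Fin m => LockKey.A z b (m + 2) (k + 4) : Fin (m + 1) → ℕ) k =
      z (m + 2) / 2 * ∏ k ∈ Finset.range (m + 2 - 1), LockKey.A z b (m + 2) (k + 3) := by
    obtain ⟨q, hq⟩ := (hz (m + 2) (by omega) le_rfl).2
    rw [hf0, Fin.prod_univ_succ, Fin.cons_zero, show m + 2 - 1 = m + 1 by omega,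
      Finset.prod_range_succ', Finset.prod_range, hc₀, show z (m + 2) / 2 = q by omega, hq]
    simp only [Fin.cons_succ, add_assoc]
    norm_num
    ring
  rw [hR] at hdec
  have hlen : (m + 2) * z (m + 2) / 2 *
      ∏ k ∈ Finset.range (m + 2 - 1), LockKey.A z b (m + 2) (k + 3) =
      (m + 2) * (z (m + 2) / 2 *
        ∏ k ∈ Finset.range (m + 2 - 1), LockKey.A z b (m + 2) (k + 3)) := by
    rw [Nat.mul_div_assoc _ (hz (m + 2) (by omega) le_rfl).2.two_dvd, mul_assoc]
  have hdvd : ∀ k ∈ Finset.range (m + 2 - 1), LockKey.A z b (m + 2) (k + 3) ∣ z (k + 1) := by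
    intro k hk
    rw [Finset.mem_range] at hk
    rcases k with _ | k
    · exact hA3
    · exact (Dvd.intro_left 2 rfl).trans (hAd k (by omega))
  rw [hlen]
  refine hdec.exists_isDecomposition (by omega) ?_ ?_
  · have h1 : 0 < ∏ k ∈ Finset.range (m + 2 - 1), LockKey.A z b (m + 2) (k + 3) := by
      refine Finset.prod_pos fun k hk => Nat.pos_of_dvd_of_pos (hdvd k hk) ?_
      rw [Finset.mem_range] at hk
      exact (hz _ (by omega) (by omega)).1
    have h2 : 2 ≤ z (m + 2) / 2 := by
      have := Nat.le_of_dvd (hz (m + 2) (by omega) le_rfl).1 h4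
      omega
    exact Nat.mul_le_mul h2 h1
  · have h1 : (∏ k ∈ Finset.range (m + 2 - 1), z (k + 1) / LockKey.A z b (m + 2) (k + 3)) *
        ∏ k ∈ Finset.range (m + 2 - 1), LockKey.A z b (m + 2) (k + 3) =
        ∏ k ∈ Finset.range (m + 2 - 1), z (k + 1) := by
      rw [← Finset.prod_mul_distrib]
      exact Finset.prod_congr rfl fun k hk => Nat.div_mul_cancel (hdvd k hk)
    have h2 : ∏ i, LockKey.factorLength z (m + 2) i =
        z (m + 2) * ∏ k ∈ Finset.range (m + 2 - 1), z (k + 1) := by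
      rw [← Equiv.prod_comp (Equiv.swap 0 1), Fin.prod_univ_succ, hf0, Fin.prod_univ_succ, hf1,
        show m + 2 - 1 = m + 1 by omega, Finset.prod_range_succ', Finset.prod_range]
      simp only [hf2]
      rw [mul_comm (z 1)]
    obtain ⟨q, hq⟩ := (hz (m + 2) (by omega) le_rfl).2
    rw [h2, ← h1, show z (m + 2) / 2 = q by omega, hq]
    ring
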